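/- Let $L$ be a language consisting of relation symbols, each of arity at least $1$, and function symbols, each of arity $0$ (*constants*) or $1$ (*unary functions*). There may be infinitely many symbols. Let $\Gamma_L$ be a group of permutations of $L$ which preserve types (relation or function) and arities. A *$\Gamma_L$-structure* $\mathbf A$ has a (possibly empty) vertex set $A$, relations $R_{\mathbf A}\subseteq A^{n}$ for every $n$-ary relation symbol $R$, and set-valued functions $F_{\mathbf A}\colon A^{n}\to\mathcal P(A)$ for every $n$-ary function symbol $F$. It is finite if $A$ is finite. For a constant $c$, write $c_{\mathbf A}\subseteq A$ for its value. An *embedding* $f\colon\mathbf A\to\mathbf B$ is a pair $(f_L,f_A)$, where $f_L\in\Gamma_L$ and $f_A\colon A\to B$ is injective, such that $\bar x\in R_{\mathbf A}\iff f_A(\bar x)\in f_L(R)_{\mathbf B}$ and $f_A(F_{\mathbf A}(\bar x))=f_L(F)_{\mathbf B}(f_A(\bar x))$ for all symbols $R$, $F$ and all tuples $\bar x$ of vertices of $\mathbf A$. It is an *isomorphism* if $f_A$ is bijective, and an *automorphism* if moreover $\mathbf A=\mathbf B$. Composition of such maps is taken in both coordinates. $\mathbf A$ is a *substructure* of $\mathbf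 B$ if $A\subseteq B$ and $(\mathrm{id}_L,\text{inclusion})$ is an embedding. A *partial automorphism* of $\mathbf A$ is an isomorphism between two substructures of $\mathbf A$; an automorphism extends it if it has the same language part and extends its vertex part. For $g\in\Gamma_L$, the *relabelled* structure $g\mathbf A$ has vertex set $A$, $R_{g\mathbf A}=(g^{-1}R)_{\mathbf A}$ and $F_{g\mathbf A}=(g^{-1}F)_{\mathbf A}$. A structure $\mathbf C$ is the *free amalgamation* of its substructures $\mathbf C_1,\mathbf C_2$ if $C=C_1\cup C_2$ and every tuple $\bar x$ of vertices of $\mathbf C$ that contains a vertex of $C_1\setminus C_2$ and a vertex of $C_2\setminus C_1$ is in no relation of $\mathbf C$ and satisfies $F_{\mathbf C}(\bar x)=\emptyset$ for every function symbol $F$ of arity $|\bar x|$. A structure is *irreducible* if it is not the free amalgamation of two proper substructures. Let $\psi\colon\mathbf A\to\mathbf B$ be an embedding of finite $\Gamma_L$-structures, and let $\psi(\mathbf A)$ be the substructure of $\mathbf B$ with vertex set $\psi(A)$. We say that $\mathbf B$ is, with respect to $\psi$, * a *coherent EPPA-witness* for $\mathbf A$ if one can assign to every partial automorphism $f$ of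 $\psi(\mathbf A)$ an automorphism $\hat f$ of $\mathbf B$ extending $f$ so that $\hat h=\hat g\circ\hat f$ whenever $f,g,h$ are partial automorphisms of $\psi(\mathbf A)$ with $\mathrm{Dom}(f)=\mathrm{Dom}(h)$, $\mathrm{Range}(f)=\mathrm{Dom}(g)$, $\mathrm{Range}(g)=\mathrm{Range}(h)$ and $h=g\circ f$; * *irreducible structure faithful* if for every irreducible substructure $\mathbf C$ of $\mathbf B$ there is an automorphism $g$ of $\mathbf B$ with $g(C)\subseteq\psi(A)$. **Theorem.** Let $L$ and $\Gamma_L$ be as above, let $\mathbf A$ be a finite $\Gamma_L$-structure, and assume the following: 1. $g(c)=c$ for every $g\in\Gamma_L$ and every constant $c\in L$. 2. $L$ has finitely many constants. 3. $c_{\mathbf A}$ is a singleton for every constant $c\in L$. 4. $c_{\mathbf A}\neq c'_{\mathbf A}$ for all distinct constants $c,c'\in L$. 5. For every constant $c\in L$ with $c_{\mathbf A}=\{a\}$ and every unary function $F\in L$, $F_{\mathbf A}(a)=\emptyset$. 6. The orbit $\{g\mathbf A: g\in\Gamma_L\}$ of $\mathbf A$ under relabelling is finite. Then there are a finite $\Gamma_L$-structure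 $\mathbf B$ and an embedding $\psi\colon\mathbf A\to\mathbf B$ with respect to which $\mathbf B$ is both a coherent EPPA-witness for $\mathbf A$ and irreducible structure faithful. -/

import Mathlib

universe u v w w'

namespace EPPA

/-- Permutations of the symbols of a language which preserve types (relation or function) and
arities. The symbols of `L` of arity `n` are `L.Relations n` and `L.Functions n`, so such a
permutation is the same as a permutation of each of these sets. -/
abbrev LangPerm (L : FirstOrder.Language.{u, v}) : Type (max u v) :=
  (∀ n, Equiv.Perm (L.Relations n)) × (∀ n, Equiv.Perm (L.Functions n))

/-- Structures with vertex set `A`, where an `n`-ary function goes from `A ^ n` to the set of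
all subsets of `A`. -/
@[ext]
structure GStr (L : FirstOrder.Language.{u, v}) (A : Type w) where
  rel : ∀ {n : ℕ}, L.Relations n → Set (Fin n → A)
  func : ∀ {n : ℕ}, L.Functions n → (Fin n → A) → Set A

namespace GStr

variable {L : FirstOrder.Language.{u, v}} {A : Type w} {B : Type w'}

/-- The value of a constant symbol (a subset of the vertex set). -/
def const (M : GStr L A) (c : L.Functions 0) : Set A := M.func c ![]

/-- The structure `g M`, the image of `M` under the pair `(g, id)`. -/
def relabel (g : LangPerm L) (M : GStr L A) : GStr L A where
  rel {n} R := M.rel ((g.1 n).symm R)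
  func {n} F := M.func ((g.2 n).symm F)

/-- The orbit of `M` under the action of the group `Γ` by relabelling. -/
def relabelOrbit (Γ : Subgroup (LangPerm L)) (M : GStr L A) : Set (GStr L A) :=
  {N | ∃ g ∈ Γ, N = M.relabel g}

/-- The pair `(g, f)` is an embedding of `M` into `N`. -/
structure IsEmbedding (g : LangPerm L) (f : A → B) (M : GStr L A) (N : GStr L B) : Prop where
  injective : Function.Injective f
  rel_iff : ∀ {n : ℕ} (R : L.Relations n) (x : Fin n → A),
    x ∈ M.rel R ↔ f ∘ x ∈ N.rel (g.1 n R)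
  func_eq : ∀ {n : ℕ} (F : L.Functions n) (x : Fin n → A),
    f '' M.func F x = N.func (g.2 n F) (f ∘ x)

/-- `S` is the vertex set of a substructure of `M`. -/
def IsClosed (M : GStr L A) (S : Set A) : Prop :=
  ∀ {n : ℕ} (F : L.Functions n) (x : Fin n → A), (∀ i, x i ∈ S) → M.func F x ⊆ S

/-- The structure induced by `M` on `S`. For closed `S` this is the substructure of `M` with
vertex set `S`. -/
def induce (M : GStr L A) (S : Set A) : GStr L S where
  rel R := {x | (fun i => (x i : A)) ∈ M.rel R}
  func F x := {y | (y : A) ∈ M.func F (fun i => (x i : A))}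

/-- `M` is the free amalgamation of its substructures on `S` and `T` (over the one on
`S ∩ T`). -/
structure IsFreeAmalgamation (M : GStr L A) (S T : Set A) : Prop where
  closed_left : M.IsClosed S
  closed_right : M.IsClosed T
  cover : S ∪ T = Set.univ
  rel_free : ∀ {n : ℕ} (R : L.Relations n) (x : Fin n → A),
    (∃ i, x i ∈ S \ T) → (∃ j, x j ∈ T \ S) → x ∉ M.rel R
  func_free : ∀ {n : ℕ} (F : L.Functions n) (x : Fin n → A),
    (∃ i, x i ∈ S \ T) → (∃ j, x j ∈ T \ S) → M.func F x = ∅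

/-- `M` is not the free amalgamation of its proper substructures. -/
def Irreducible (M : GStr L A) : Prop :=
  ¬ ∃ S T : Set A, S ≠ Set.univ ∧ T ≠ Set.univ ∧ M.IsFreeAmalgamation S T

end GStr

section

variable {L : FirstOrder.Language.{u, v}} {A : Type w} {B : Type w'}

/-- Embeddings `(lang, toFun)` with language part in `Γ`. -/
structure Emb (Γ : Subgroup (LangPerm L)) (M : GStr L A) (N : GStr L B) where
  lang : LangPerm L
  lang_mem : lang ∈ Γ
  toFun : A → B
  isEmbedding : GStr.IsEmbedding lang toFun M N

/-- Automorphisms `(lang, toPerm)` with language part in `Γ`. -/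
structure Aut (Γ : Subgroup (LangPerm L)) (N : GStr L B) where
  lang : LangPerm L
  lang_mem : lang ∈ Γ
  toPerm : Equiv.Perm B
  isEmbedding : GStr.IsEmbedding lang toPerm N N

/-- Partial automorphisms of `N`: isomorphisms `(lang, map)` between the substructures of `N`
with vertex sets `dom` and `cod`. -/
structure PartialAut (Γ : Subgroup (LangPerm L)) (N : GStr L B) where
  lang : LangPerm L
  lang_mem : lang ∈ Γ
  dom : Set B
  cod : Set B
  dom_closed : N.IsClosed dom
  cod_closed : N.IsClosed cod
  map : dom ≃ cod
  isEmbedding : GStr.IsEmbedding lang map (N.induce dom) (N.induce cod)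

variable {Γ : Subgroup (LangPerm L)} {M : GStr L A} {N : GStr L B}

/-- `f` is a partial automorphism of the substructure of `N` with vertex set `S`. (When `S` is
closed in `N`, the substructures of this substructure are those of `N` which are contained
in `S`.) -/
def PartialAut.Within (f : PartialAut Γ N) (S : Set B) : Prop :=
  f.dom ⊆ S ∧ f.cod ⊆ S

/-- The automorphism `e` extends `f` (in particular they have the same language part). -/
def PartialAut.ExtendsTo (f : PartialAut Γ N) (e : Aut Γ N) : Prop :=
  e.lang = f.lang ∧ ∀ x : f.dom, e.toPerm x = f.map x

/-- `(f, g, h)` is a coherent triple: the domains and ranges fit and `h = g ∘ f`, for both the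
vertex and the language part. -/
structure PartialAut.IsCoherentTriple (f g h : PartialAut Γ N) : Prop where
  dom_eq : f.dom = h.dom
  range_eq_dom : f.cod = g.dom
  range_eq : g.cod = h.cod
  lang_eq : h.lang = g.lang * f.lang
  map_eq : ∀ (x : B) (hf : x ∈ f.dom) (hg : (f.map ⟨x, hf⟩ : B) ∈ g.dom) (hh : x ∈ h.dom),
    (h.map ⟨x, hh⟩ : B) = g.map ⟨f.map ⟨x, hf⟩, hg⟩

/-- Coherence of a triple of automorphisms (the domains and ranges always fit). -/
def Aut.IsCoherentTriple (f g h : Aut Γ N) : Prop :=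
  h.lang = g.lang * f.lang ∧ h.toPerm = g.toPerm * f.toPerm

/-- The partial automorphisms of `ψ(M)`. -/
abbrev Emb.ImagePartialAut (ψ : Emb Γ M N) : Type _ :=
  {f : PartialAut Γ N // f.Within (Set.range ψ.toFun)}

/-- `N` is a coherent EPPA-witness for `M` via the embedding `ψ`: there is a coherent map
which assigns to each partial automorphism of `ψ(M)` an automorphism of `N` extending it. -/
def IsCoherentEPPAWitness (ψ : Emb Γ M N) : Prop :=
  ∃ E : ψ.ImagePartialAut → Aut Γ N,
    (∀ f : ψ.ImagePartialAut, f.1.ExtendsTo (E f)) ∧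
    ∀ f g h : ψ.ImagePartialAut, PartialAut.IsCoherentTriple f.1 g.1 h.1 →
      Aut.IsCoherentTriple (E f) (E g) (E h)

/-- Irreducible structure faithfulness of `N` with respect to `ψ(M)`. -/
def IsIrreducibleStructureFaithful (ψ : Emb Γ M N) : Prop :=
  ∀ S : Set B, N.IsClosed S → (N.induce S).Irreducible →
    ∃ e : Aut Γ N, e.toPerm '' S ⊆ Set.range ψ.toFun

end

end EPPA

/-!
The witness is a union of translates of `M` under a finite group of permutations, obtained in three
steps.

* Only finitely many kinds of slots (a symbol with a tuple, or with arguments and a value) can be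
  told apart in the structures of the orbit of `M`. Label each vertex of `M` by the indicator
  function, with values in `ZMod p`, of the kinds of slots which hold in `M`. A permutation of the
  labelled points may change the labels, as long as for each kind the changes over the vertices of a
  slot of this kind add up to zero. If such a permutation restores the labels of all these vertices,
  then the common label difference, multiplied by the number of vertices, vanishes; for `p` larger
  than the number of vertices of `M` this means that the slot keeps its truth value. A partial
  automorphism extends to all vertices by the order-preserving bijection between the complements,
  and the label changes which it forces on its range are compensated evenly off the range; both
  choices are canonical, which gives coherence.
* Colour the points at each bad set, i.e. each set of `k + 2` points which does not fit into a
  translate of `M`, with `k + 1` colours. Points whose colours at common bad sets are distinct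
  cannot fill a bad set, so whether a set of coloured points fits into a translate of `M` is
  determined by its pairs.
* Glue the translates of `M` by identifying two vertices if they are the same point and generate the
  same set of points. Two vertices of an irreducible substructure lie in a common translate, hence
  so does the whole substructure.
-/

namespace EPPA

open Relator Set
open scoped SetRel Pointwise

section coherentExt

variable {α : Type*}

/-- The relation `r` is the graph of a bijection between subsets of `α`. -/
abbrev IsPartialBij (r : SetRel α α) : Prop := BiUnique (· ~[r] ·)

theorem IsPartialBij.comp {r s : SetRel α α} (hr : IsPartialBij r) (hs : IsPartialBij s) :
    IsPartialBij (r ○ s) := by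
  constructor
  · rintro a a' c ⟨b, hab, hbc⟩ ⟨b', hab', hbc'⟩
    obtain rfl := hs.1 hbc hbc'
    exact hr.1 hab hab'
  · rintro a c c' ⟨b, hab, hbc⟩ ⟨b', hab', hbc'⟩
    obtain rfl := hr.2 hab hab'
    exact hs.2 hbc hbc'

theorem dom_comp_of_cod_eq_dom {r s : SetRel α α} (h : r.cod = s.dom) : (r ○ s).dom = r.dom := by
  ext a
  refine ⟨fun ⟨_, b, hab, _⟩ => ⟨b, hab⟩, fun ⟨b, hab⟩ => ?_⟩
  obtain ⟨c, hbc⟩ := h.subset ⟨a, hab⟩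
  exact ⟨c, b, hab, hbc⟩

theorem cod_comp_of_cod_eq_dom {r s : SetRel α α} (h : r.cod = s.dom) : (r ○ s).cod = s.cod := by
  ext c
  refine ⟨fun ⟨_, b, _, hbc⟩ => ⟨b, hbc⟩, fun ⟨b, hbc⟩ => ?_⟩
  obtain ⟨a, hab⟩ := h.superset ⟨c, hbc⟩
  exact ⟨a, b, hab, hbc⟩

theorem image_dom_eq_cod {r : SetRel α α} {σ : α → α} (hσ : ∀ ⦃a b⦄, a ~[r] b → σ a = b) :
    σ '' r.dom = r.cod := by
  ext b
  constructor
  · rintro ⟨_, ⟨b, h⟩, rfl⟩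
    exact ⟨_, by rwa [hσ h]⟩
  · rintro ⟨a, h⟩
    exact ⟨a, ⟨b, h⟩, hσ h⟩

theorem IsPartialBij.exists_equiv {r : SetRel α α} (hr : IsPartialBij r) :
    ∃ e : r.dom ≃ r.cod, ∀ a : r.dom, (a : α) ~[r] (e a : α) := by
  choose f hf using fun a : r.dom => a.2
  refine ⟨Equiv.ofBijective (fun a => ⟨f a, a, hf a⟩) ⟨fun a a' h => ?_, fun ⟨b, a, hab⟩ => ?_⟩, hf⟩
  · exact Subtype.ext (hr.1 (hf a) (by rw [Subtype.mk_eq_mk.1 h]; exact hf a'))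
  · exact ⟨⟨a, b, hab⟩, Subtype.ext (hr.2 (hf _) hab)⟩

variable [LinearOrder α]

/-- The permutation `σ` extends the partial bijection `r`, and is increasing outside the domain
of `r`. -/
structure IsMonotoneExtension (r : SetRel α α) (σ : Equiv.Perm α) : Prop where
  apply_eq : ∀ ⦃a b⦄, a ~[r] b → σ a = b
  strictMonoOn : StrictMonoOn σ r.domᶜ

namespace IsMonotoneExtension

variable {r s : SetRel α α} {σ τ : Equiv.Perm α}

theorem image_dom_compl (hσ : IsMonotoneExtension r σ) : σ '' r.domᶜ = r.codᶜ := by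
  rw [image_compl_eq σ.bijective, image_dom_eq_cod hσ.apply_eq]

theorem eq [Finite α] (hσ : IsMonotoneExtension r σ) (hτ : IsMonotoneExtension r τ) : σ = τ := by
  have hcompl : r.domᶜ.domRestrict σ = r.domᶜ.domRestrict τ := by
    rw [← StrictMono.range_inj (strictMono_domRestrict.2 hσ.strictMonoOn)
      (strictMono_domRestrict.2 hτ.strictMonoOn), range_domRestrict, range_domRestrict,
      hσ.image_dom_compl, hτ.image_dom_compl]
  ext a
  by_cases ha : a ∈ r.dom
  · obtain ⟨b, hab⟩ := ha
    rw [hσ.apply_eq hab, hτ.apply_eq hab]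
  · exact congrFun hcompl ⟨a, ha⟩

theorem comp (hσ : IsMonotoneExtension r σ) (hτ : IsMonotoneExtension s τ) (h : r.cod = s.dom) :
    IsMonotoneExtension (r ○ s) (τ * σ) where
  apply_eq := by
    rintro a c ⟨b, hab, hbc⟩
    rw [Equiv.Perm.mul_apply, hσ.apply_eq hab, hτ.apply_eq hbc]
  strictMonoOn := by
    rw [dom_comp_of_cod_eq_dom h]
    refine hτ.strictMonoOn.comp hσ.strictMonoOn fun a ha => ?_
    rw [← h, ← hσ.image_dom_compl]
    exact mem_image_of_mem σ ha

end IsMonotoneExtension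

theorem IsPartialBij.exists_isMonotoneExtension [Finite α] {r : SetRel α α}
    (hr : IsPartialBij r) : ∃ σ, IsMonotoneExtension r σ := by
  classical
  have := Fintype.ofFinite α
  obtain ⟨e, he⟩ := hr.exists_equiv
  have hcard : Fintype.card {a // a ∉ r.cod} = Fintype.card {a // a ∉ r.dom} :=
    (Fintype.card_compl_eq_card_compl _ _ (Fintype.card_congr e)).symm
  let o : {a // a ∉ r.dom} ≃o {a // a ∉ r.cod} :=
    (Fintype.orderIsoFinOfCardEq _ rfl).symm.trans (Fintype.orderIsoFinOfCardEq _ hcard)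
  have hcompl : ∀ a (ha : a ∉ r.dom), e.subtypeCongr o.toEquiv a = o ⟨a, ha⟩ := fun a ha => by
    simp [Equiv.subtypeCongr, Equiv.sumCompl_symm_apply_of_neg ha]
  refine ⟨e.subtypeCongr o.toEquiv, fun a b hab => ?_, fun a ha b hb hab => ?_⟩
  · have ha : a ∈ r.dom := ⟨b, hab⟩
    simpa [Equiv.subtypeCongr, Equiv.sumCompl_symm_apply_of_pos ha] using hr.2 (he ⟨a, ha⟩) hab
  · rw [hcompl a ha, hcompl b hb]
    exact o.strictMono hab

open Classical in
/-- The extension of a partial bijection `r` which is increasing outside its domain. -/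
noncomputable def coherentExt [Finite α] (r : SetRel α α) : Equiv.Perm α :=
  if h : ∃ σ, IsMonotoneExtension r σ then h.choose else 1

theorem IsPartialBij.isMonotoneExtension_coherentExt [Finite α] {r : SetRel α α}
    (hr : IsPartialBij r) : IsMonotoneExtension r (coherentExt r) := by
  rw [coherentExt, dif_pos hr.exists_isMonotoneExtension]
  exact hr.exists_isMonotoneExtension.choose_spec

theorem coherentExt_apply [Finite α] {r : SetRel α α} (hr : IsPartialBij r) {a b : α}
    (hab : a ~[r] b) : coherentExt r a = b :=
  hr.isMonotoneExtension_coherentExt.apply_eq hab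

theorem coherentExt_comp [Finite α] {r s : SetRel α α} (hr : IsPartialBij r)
    (hs : IsPartialBij s) (h : r.cod = s.dom) :
    coherentExt (r ○ s) = coherentExt s * coherentExt r :=
  (hr.comp hs).isMonotoneExtension_coherentExt.eq
    (hr.isMonotoneExtension_coherentExt.comp hs.isMonotoneExtension_coherentExt h)

end coherentExt

namespace GStr

variable {L : FirstOrder.Language.{u, v}} {A : Type w} {B : Type w'} {M : GStr L A} {N : GStr L B}

theorem isClosed_sInter {𝒮 : Set (Set A)} (h : ∀ S ∈ 𝒮, M.IsClosed S) : M.IsClosed (⋂₀ 𝒮) :=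
  fun F x hx => subset_sInter fun S hS => h S hS F x fun i => hx i S hS

theorem isClosed_univ : M.IsClosed univ := fun _ _ _ => subset_univ _

/-- The vertex set of the substructure of `M` generated by a set of vertices. -/
def closure (M : GStr L A) : ClosureOperator (Set A) :=
  .ofCompletePred M.IsClosed fun _ h => isClosed_sInter h

theorem subset_closure (S : Set A) : S ⊆ M.closure S := M.closure.le_closure S

theorem isClosed_closure (S : Set A) : M.IsClosed (M.closure S) := M.closure.isClosed_closure S

theorem closure_subset {S T : Set A} (hST : S ⊆ T) (hT : M.IsClosed T) : M.closure S ⊆ T :=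
  M.closure.closure_min hST hT

/-- The vertex set of the least substructure of `M`, which every partial automorphism of `M`
contains in its domain and in its range. -/
def core (M : GStr L A) : Set A := M.closure ∅

theorem core_subset {S : Set A} (hS : M.IsClosed S) : M.core ⊆ S :=
  closure_subset (empty_subset S) hS

theorem core_subset_closure (S : Set A) : M.core ⊆ M.closure S := core_subset (isClosed_closure S)

theorem mem_closure_singleton (a : A) : a ∈ M.closure {a} := subset_closure _ rfl

theorem closure_singleton_subset {a : A} {S : Set A} (ha : a ∈ S) (hS : M.IsClosed S) :
    M.closure {a} ⊆ S :=
  closure_subset (singleton_subset_iff.2 ha) hS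

theorem isClosed_of_closure_singleton_subset {S : Set A} (h0 : M.core ⊆ S)
    (hFun : ∀ n, 2 ≤ n → IsEmpty (L.Functions n)) (hS : ∀ a ∈ S, M.closure {a} ⊆ S) :
    M.IsClosed S := by
  rintro (_ | _ | n) F x hx
  · exact fun y hy => h0 (isClosed_closure ∅ F x Fin.rec0 hy)
  · refine (isClosed_closure {x 0} F x fun i => ?_).trans (hS _ (hx 0))
    obtain rfl := Subsingleton.elim (α := Fin 1) i 0
    exact mem_closure_singleton _
  · exact (hFun _ (by omega)).elim F

namespace IsEmbedding

variable {g : LangPerm L} {f : A → B}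

theorem comp {C : Type*} {N' : GStr L C} {g' : LangPerm L} {f' : B → C}
    (hf' : IsEmbedding g' f' N N') (hf : IsEmbedding g f M N) :
    IsEmbedding (g' * g) (f' ∘ f) M N' where
  injective := hf'.injective.comp hf.injective
  rel_iff R x := (hf.rel_iff R x).trans (hf'.rel_iff _ _)
  func_eq F x := by rw [image_comp, hf.func_eq, hf'.func_eq]; rfl

theorem mem_func_iff (hf : IsEmbedding g f M N) {n : ℕ} (F : L.Functions n) (x : Fin n → A)
    (a : A) :
    a ∈ M.func F x ↔ f a ∈ N.func (g.2 n F) (f ∘ x) := by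
  rw [← hf.func_eq, hf.injective.mem_set_image]

theorem isClosed_image (hf : IsEmbedding g f M N) {S : Set A} (hS : M.IsClosed S) :
    N.IsClosed (f '' S) := by
  intro n F y hy
  choose x hx hxy using hy
  obtain rfl : f ∘ x = y := funext hxy
  obtain ⟨F, rfl⟩ := (g.2 n).surjective F
  rw [← hf.func_eq]
  exact image_mono (hS F x hx)

theorem isClosed_preimage (hf : IsEmbedding g f M N) {T : Set B} (hT : N.IsClosed T) :
    M.IsClosed (f ⁻¹' T) := by
  intro n F x hx
  rw [← image_subset_iff, hf.func_eq]
  exact hT _ _ hx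

end IsEmbedding

theorem isEmbedding_induce {V : Set A} (hV : M.IsClosed V) :
    IsEmbedding 1 Subtype.val (M.induce V) M where
  injective := Subtype.val_injective
  rel_iff _ _ := Iff.rfl
  func_eq F x := Subtype.image_preimage_coe V _ |>.trans <|
    inter_eq_right.2 (hV F _ fun i => (x i).2)

theorem Irreducible.exists_rel_or_closure (hN : N.Irreducible)
    (hFun : ∀ n, 2 ≤ n → IsEmpty (L.Functions n)) (x y : B) :
    (∃ z, x ∈ N.closure {z} ∧ y ∈ N.closure {z}) ∨
      ∃ (n : ℕ) (R : L.Relations n), ∃ t ∈ N.rel R, ∃ i j,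
        x ∈ N.closure {t i} ∧ y ∈ N.closure {t j} := by
  have isClosed_avoiding : ∀ a ∉ N.core, N.IsClosed {z | a ∉ N.closure {z}} := fun a ha =>
    isClosed_of_closure_singleton_subset
      (fun z hz haz => ha (closure_singleton_subset hz (isClosed_closure _) haz))
      hFun
      fun z hz w hw haw => hz (closure_singleton_subset hw (isClosed_closure _) haw)
  by_contra! h
  have hx : x ∉ N.core := fun hx => h.1 y (core_subset_closure _ hx) (mem_closure_singleton y)
  have hy : y ∉ N.core := fun hy => h.1 x (mem_closure_singleton x) (core_subset_closure _ hy)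
  refine hN ⟨{z | x ∉ N.closure {z}}, {z | y ∉ N.closure {z}},
    ne_univ_iff_exists_notMem _ |>.2 ⟨x, fun hxx => hxx (mem_closure_singleton x)⟩,
    ne_univ_iff_exists_notMem _ |>.2 ⟨y, fun hyy => hyy (mem_closure_singleton y)⟩,
    isClosed_avoiding x hx, isClosed_avoiding y hy, ?_, ?_, ?_⟩
  · refine eq_univ_of_forall fun z => or_iff_not_imp_left.2 fun hz => h.1 z (not_not.1 hz)
  · rintro n R t ⟨i, -, hi⟩ ⟨j, -, hj⟩ ht
    exact h.2 n R t ht j i (not_not.1 hj) (not_not.1 hi)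
  · rintro (_ | _ | n) F t ⟨i, hi, -⟩ ⟨j, -, hj⟩
    · exact i.elim0
    · exact absurd (Subsingleton.elim (α := Fin 1) i j ▸ hi) hj
    · exact (hFun _ (by omega)).elim F

end GStr

section partialIso

variable {L : FirstOrder.Language.{u, v}} {A : Type w}

/-- The pair `(g, r)` is a partial automorphism of `M` whose vertex part is given by its graph
`r`. -/
structure IsPartialIso (M : GStr L A) (g : LangPerm L) (r : SetRel A A) : Prop where
  isPartialBij : IsPartialBij r
  dom_closed : M.IsClosed r.dom
  cod_closed : M.IsClosed r.cod
  rel_iff : ∀ {n : ℕ} (R : L.Relations n) (x y : Fin n → A), (∀ i, x i ~[r] y i) →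
    (x ∈ M.rel R ↔ y ∈ M.rel (g.1 n R))
  func_iff : ∀ {n : ℕ} (F : L.Functions n) (x y : Fin n → A) (a b : A), (∀ i, x i ~[r] y i) →
    a ~[r] b → (a ∈ M.func F x ↔ b ∈ M.func (g.2 n F) y)

namespace IsPartialIso

variable {M : GStr L A} {g : LangPerm L} {r : SetRel A A} {σ : Equiv.Perm A}

theorem inv (hr : IsPartialIso M g r) : IsPartialIso M g⁻¹ r.inv where
  isPartialBij :=
    ⟨fun _ _ _ h h' => hr.isPartialBij.2 h h', fun _ _ _ h h' => hr.isPartialBij.1 h h'⟩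
  dom_closed := hr.cod_closed
  cod_closed := hr.dom_closed
  rel_iff R x y h := by simpa using (hr.rel_iff ((g⁻¹).1 _ R) y x h).symm
  func_iff F x y a b h hab := by simpa using (hr.func_iff ((g⁻¹).2 _ F) y x b a h hab).symm

theorem isClosed_image (hr : IsPartialIso M g r) {S : Set A} (hS : M.IsClosed S) :
    M.IsClosed (r.image S) := by
  intro n F y hy b hb
  choose x hxS hxy using hy
  obtain ⟨a, hab⟩ := hr.cod_closed F y (fun i => ⟨x i, hxy i⟩) hb
  obtain ⟨F, rfl⟩ := (g.2 n).surjective F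
  exact ⟨a, hS F x hxS ((hr.func_iff F x y a b hxy hab).2 hb), hab⟩

theorem mem_core_of_rel (hr : IsPartialIso M g r) {a b : A} (hab : a ~[r] b) (hb : b ∈ M.core) :
    a ∈ M.core := by
  obtain ⟨a', ha', hab'⟩ := GStr.core_subset (hr.isClosed_image (GStr.isClosed_closure ∅)) hb
  rwa [hr.isPartialBij.1 hab hab']

theorem mem_core_iff (hr : IsPartialIso M g r) {a b : A} (hab : a ~[r] b) :
    a ∈ M.core ↔ b ∈ M.core :=
  ⟨hr.inv.mem_core_of_rel hab, hr.mem_core_of_rel hab⟩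

theorem func_comp_eq_image (hr : IsPartialIso M g r) (hσ : ∀ a b, a ~[r] b → σ a = b) {n : ℕ}
    (F : L.Functions n) {x : Fin n → A} (hx : ∀ i, x i ∈ r.dom) :
    M.func (g.2 n F) (σ ∘ x) = σ '' M.func F x := by
  have hxσ : ∀ i, x i ~[r] σ (x i) := fun i => by
    obtain ⟨b, hb⟩ := hx i
    rwa [hσ _ _ hb]
  ext b
  constructor
  · intro hb
    obtain ⟨a, hab⟩ := hr.cod_closed _ _ (fun i => ⟨x i, hxσ i⟩) hb
    exact ⟨a, (hr.func_iff F x _ a b hxσ hab).2 hb, hσ a b hab⟩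
  · rintro ⟨a, ha, rfl⟩
    obtain ⟨b, hab⟩ := hr.dom_closed F x hx ha
    rw [hσ a b hab]
    exact (hr.func_iff F x _ a b hxσ hab).1 ha

end IsPartialIso

end partialIso

section slot

/-- The group `H` records a language part, and only the second coordinate acts on points. -/
instance permProdAction {H X : Type*} [Group H] : MulAction (H × Equiv.Perm X) X :=
  MulAction.compHom X (MonoidHom.snd H (Equiv.Perm X))

theorem permProd_smul_def {H X : Type*} [Group H] (γ : H × Equiv.Perm X) (x : X) :
    γ • x = γ.2 x := rfl

/-- A relation or a function symbol together with a possible tuple of the relation, or with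
arguments and a possible value of the function. -/
inductive Slot (L : FirstOrder.Language.{u, v}) (A : Type w) : Type (max u v w)
  | rel {n : ℕ} (R : L.Relations n) (x : Fin n → A)
  | func {n : ℕ} (F : L.Functions n) (x : Fin n → A) (S : Set A)

variable {L : FirstOrder.Language.{u, v}} {A : Type w} {Γ : Subgroup (LangPerm L)}

namespace Slot

/-- The vertices which occur in a slot. -/
def vertices : Slot L A → Set A
  | rel _ x => range x
  | func _ x S => range x ∪ S

/-- The slot records the actual behaviour of its symbol in `M`. -/
def Holds (M : GStr L A) : Slot L A → Prop
  | rel R x => x ∈ M.rel R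
  | func F x S => M.func F x = S

instance : MulAction (Γ × Equiv.Perm A) (Slot L A) where
  smul θ
    | rel R x => rel (θ.1.1.1 _ R) (θ.2 ∘ x)
    | func F x S => func (θ.1.1.2 _ F) (θ.2 ∘ x) (θ.2 '' S)
  one_smul s := by
    rcases s with _ | ⟨F, x, S⟩
    · rfl
    · exact congrArg (func F x) (image_id S)
  mul_smul θ θ' s := by
    rcases s with _ | ⟨F, x, S⟩
    · rfl
    · exact congrArg (func _ _) (image_comp θ.2 θ'.2 S)

theorem smul_func (θ : Γ × Equiv.Perm A) {n : ℕ} (F : L.Functions n) (x : Fin n → A) (S : Set A) :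
    θ • func F x S = func (θ.1.1.2 n F) (θ.2 ∘ x) (θ.2 '' S) := rfl

theorem vertices_smul (θ : Γ × Equiv.Perm A) (s : Slot L A) :
    (θ • s).vertices = θ • s.vertices := by
  rcases s with ⟨_, x⟩ | ⟨F, x, S⟩
  · exact range_comp θ.2 x
  · exact (congrArg (· ∪ _) (range_comp θ.2 x)).trans (image_union ..).symm

theorem smul_congr {g : Γ} {σ τ : Equiv.Perm A} {s : Slot L A} (h : EqOn σ τ s.vertices) :
    (g, σ) • s = (g, τ) • s := by
  rcases s with ⟨_, x⟩ | ⟨F, x, S⟩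
  · exact congrArg (rel _) (funext fun i => h (mem_range_self i))
  · exact congrArg₂ (func _) (funext fun i => h (.inl (mem_range_self i)))
      (image_congr fun a ha => h (.inr ha))

end Slot

theorem IsPartialIso.holds_smul_iff {M : GStr L A} {g : Γ} {r : SetRel A A}
    (hr : IsPartialIso M g r) {σ : Equiv.Perm A} (hσ : ∀ a b, a ~[r] b → σ a = b) {s : Slot L A}
    (hs : s.vertices ⊆ r.dom) : ((g, σ) • s).Holds M ↔ s.Holds M := by
  rcases s with ⟨R, x⟩ | ⟨F, x, S⟩
  · refine (hr.rel_iff R x _ fun i => ?_).symm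
    obtain ⟨b, hb⟩ := hs (mem_range_self i)
    rwa [Function.comp_apply, hσ _ _ hb]
  · rw [Slot.smul_func, Slot.Holds,
      hr.func_comp_eq_image hσ F fun i => hs (.inl (mem_range_self i))]
    exact σ.injective.image_injective.eq_iff

/-- Relabelling by the first coordinate and transport of structure along the second one. -/
instance : MulAction (Γ × Equiv.Perm A) (GStr L A) where
  smul θ M :=
    { rel := fun R => {x | θ.2.symm ∘ x ∈ M.rel ((θ.1.1.1 _).symm R)}
      func := fun F x => θ.2 '' M.func ((θ.1.1.2 _).symm F) (θ.2.symm ∘ x) }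
  one_smul M := GStr.ext rfl (by funext n F x; exact image_id _)
  mul_smul θ θ' M := GStr.ext rfl (by funext n F x; exact image_comp θ.2 θ'.2 _)

theorem Slot.holds_smul_smul (θ : Γ × Equiv.Perm A) (s : Slot L A) (M : GStr L A) :
    (θ • s).Holds (θ • M) ↔ s.Holds M := by
  rcases s with ⟨R, x⟩ | ⟨F, x, S⟩
  · change θ.2.symm ∘ θ.2 ∘ x ∈ M.rel ((θ.1.1.1 _).symm (θ.1.1.1 _ R)) ↔ _
    rw [Equiv.symm_apply_apply, ← Function.comp_assoc, Equiv.symm_comp_self, Function.id_comp]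
    rfl
  · change θ.2 '' M.func ((θ.1.1.2 _).symm (θ.1.1.2 _ F)) (θ.2.symm ∘ θ.2 ∘ x) = θ.2 '' S ↔ _
    rw [Equiv.symm_apply_apply, ← Function.comp_assoc, Equiv.symm_comp_self, Function.id_comp]
    exact θ.2.injective.image_injective.eq_iff

theorem finite_orbit [Finite A] {M : GStr L A} (horbit : (M.relabelOrbit Γ).Finite) :
    (MulAction.orbit (Γ × Equiv.Perm A) M).Finite := by
  refine (horbit.image2 (fun N σ => ((1 : Γ), σ) • N) (finite_univ (α := Equiv.Perm A))).subset ?_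
  rintro _ ⟨⟨g, σ⟩, rfl⟩
  exact ⟨M.relabel g, ⟨g, g.2, rfl⟩, σ, mem_univ σ, rfl⟩

end slot

section slotCoding

variable {L : FirstOrder.Language.{u, v}} {A : Type w} {Γ : Subgroup (LangPerm L)}

/-- A classification of the slots over `A`, compatible with relabelling and with permutations of
`A`, which determines the vertices occurring in a slot and whether it holds in `M`. -/
structure SlotCoding (Γ : Subgroup (LangPerm L)) (M : GStr L A) (Q : Type*)
    [MulAction (Γ × Equiv.Perm A) Q] where
  code : Slot L A →[Γ × Equiv.Perm A] Q
  surjective : Function.Surjective code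
  supp : Q → Finset A
  coe_supp : ∀ s, (supp (code s) : Set A) = s.vertices
  marked : Set Q
  mem_marked : ∀ s, code s ∈ marked ↔ s.Holds M

theorem exists_fin_surjective_mulActionHom {G S Q : Type*} [Group G] [MulAction G S]
    [MulAction G Q] [Finite Q] (f : S →[G] Q) :
    ∃ (n : ℕ) (_ : MulAction G (Fin n)) (code : S →[G] Fin n) (decode : Fin n → Q),
      Function.Surjective code ∧ ∀ s, decode (code s) = f s := by
  let R : SubMulAction G Q :=
    { carrier := range f
      smul_mem' := fun g _ ⟨s, hs⟩ => ⟨g • s, by rw [map_smul, hs]⟩ }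
  let e : R ≃ Fin (Nat.card R) := Finite.equivFin R
  let toRange (s : S) : R := ⟨f s, mem_range_self s⟩
  let _ := e.symm.mulAction G
  refine ⟨_, inferInstance, ⟨fun s => e (toRange s), fun g s => ?_⟩, fun i => (e.symm i : Q),
    fun i => ?_, fun s => congrArg Subtype.val (e.symm_apply_apply (toRange s))⟩
  · change e (toRange (g • s)) = e (g • e.symm (e (toRange s)))
    rw [e.symm_apply_apply]
    exact congrArg e (Subtype.ext (map_smul f g s))
  · obtain ⟨s, hs⟩ := (e.symm i).2
    exact ⟨s, (e.eq_symm_apply.1 (Subtype.ext hs))⟩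

/-- The vertices which occur in a slot, and the set of the structures in the orbit of `M` in which
it holds. -/
def slotType (Γ : Subgroup (LangPerm L)) (M : GStr L A) :
    Slot L A →[Γ × Equiv.Perm A] Set A × Set (MulAction.orbit (Γ × Equiv.Perm A) M) where
  toFun s := (s.vertices, {N | s.Holds N})
  map_smul' θ s := by
    refine Prod.ext (s.vertices_smul θ) (ext fun N => ?_)
    obtain ⟨N, rfl⟩ := MulAction.surjective θ N
    change (θ • s).Holds (θ • N : GStr L A) ↔
      θ • N ∈ θ • {N : MulAction.orbit (Γ × Equiv.Perm A) M | s.Holds N}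
    rw [smul_mem_smul_set_iff]
    exact s.holds_smul_smul θ N

theorem exists_slotCoding [Finite A] {M : GStr L A} (horbit : (M.relabelOrbit Γ).Finite) :
    ∃ (n : ℕ) (_ : MulAction (Γ × Equiv.Perm A) (Fin n)), Nonempty (SlotCoding Γ M (Fin n)) := by
  have : Finite (MulAction.orbit (Γ × Equiv.Perm A) M) := finite_orbit horbit
  obtain ⟨n, hn, code, decode, hsurj, hdecode⟩ :=
    exists_fin_surjective_mulActionHom (slotType Γ M)
  exact ⟨n, hn, ⟨{
    code := code
    surjective := hsurj
    supp := fun q => (toFinite (decode q).1).toFinset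
    coe_supp := fun s => by rw [hdecode, Finite.coe_toFinset]; rfl
    marked := {q | ⟨M, MulAction.mem_orbit_self M⟩ ∈ (decode q).2}
    mem_marked := fun s => by rw [mem_ofPred_eq, hdecode]; rfl }⟩⟩

end slotCoding

section twist

variable {G A Q K : Type*} [Group G] [MulAction G A] [MulAction G Q]

/-- The action of `θ` on the points of `A` labelled by functions on `Q`, followed by adding
`τ b` to the label of each point `b`. -/
def twistedPerm [AddGroup K] (θ : G) (τ : A → Q → K) : Equiv.Perm (A × (Q → K)) where
  toFun v := (θ • v.1, fun q => v.2 (θ⁻¹ • q) + τ (θ • v.1) q)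
  invFun v := (θ⁻¹ • v.1, fun q => v.2 (θ • q) - τ v.1 (θ • q))
  left_inv v := by simp
  right_inv v := by simp

theorem twistedPerm_apply [AddGroup K] (θ : G) (τ : A → Q → K) (v : A × (Q → K)) :
    twistedPerm θ τ v = (θ • v.1, fun q => v.2 (θ⁻¹ • q) + τ (θ • v.1) q) := rfl

theorem twistedPerm_mul [AddCommGroup K] (θ θ' : G) (τ τ' : A → Q → K) :
    twistedPerm θ' τ' * twistedPerm θ τ =
      twistedPerm (θ' * θ) fun b q => τ' b q + τ (θ'⁻¹ • b) (θ'⁻¹ • q) := by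
  ext v q
  · simp [twistedPerm_apply, mul_smul]
  · simp [twistedPerm_apply, mul_smul, add_assoc, add_comm]

theorem twistedPerm_inv [AddCommGroup K] (θ : G) (τ : A → Q → K) :
    (twistedPerm θ τ)⁻¹ = twistedPerm θ⁻¹ fun b q => -τ (θ • b) (θ • q) := by
  refine inv_eq_of_mul_eq_one_left ?_
  rw [twistedPerm_mul]
  ext v q <;> simp [twistedPerm_apply]

/-- The permutations of the labelled points which act on points by an element of `G` and then
change the labels in such a way that, for each `q`, the changes over `supp q` add up to zero. -/
def twistedGroup [AddCommGroup K] (supp : Q → Finset A)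
    (hsupp : ∀ (θ : G) (q : Q) (b : A), θ • b ∈ supp (θ • q) ↔ b ∈ supp q) :
    Subgroup (G × Equiv.Perm (A × (Q → K))) where
  carrier := {γ | ∃ τ : A → Q → K, (∀ q, ∑ b ∈ supp q, τ b q = 0) ∧ γ.2 = twistedPerm γ.1 τ}
  one_mem' := ⟨0, by simp, by ext <;> simp [twistedPerm_apply]⟩
  mul_mem' := by
    rintro ⟨θ', π'⟩ ⟨θ, π⟩ ⟨τ', hτ', hπ'⟩ ⟨τ, hτ, hπ⟩
    obtain rfl : π' = twistedPerm θ' τ' := hπ'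
    obtain rfl : π = twistedPerm θ τ := hπ
    refine ⟨_, fun q => ?_, twistedPerm_mul θ θ' τ τ'⟩
    rw [Finset.sum_add_distrib, hτ' q, zero_add, ← hτ (θ'⁻¹ • q)]
    exact Finset.sum_equiv (MulAction.toPerm θ'⁻¹) (fun b => (hsupp θ'⁻¹ q b).symm) fun _ _ => rfl
  inv_mem' := by
    rintro ⟨θ, π⟩ ⟨τ, hτ, hπ⟩
    obtain rfl : π = twistedPerm θ τ := hπ
    refine ⟨_, fun q => ?_, twistedPerm_inv θ τ⟩
    rw [Finset.sum_neg_distrib, neg_eq_zero, ← hτ (θ • q)]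
    exact Finset.sum_equiv (MulAction.toPerm θ) (fun b => (hsupp θ q b).symm) fun _ _ => rfl

end twist

section balancedWeight

variable {A K : Type*} [Field K]

open Classical in
/-- The function which is one on `Y` and constant off `Y`, with sum zero over `S` (unless
`S ⊆ Y`). -/
noncomputable def balancedWeight (K : Type*) [Field K] (S : Finset A) (Y : Set A) (b : A) : K :=
  if b ∈ Y then 1 else -((S.filter (· ∈ Y)).card / (S.filter (· ∉ Y)).card : K)

theorem balancedWeight_of_mem (S : Finset A) {Y : Set A} {b : A} (hb : b ∈ Y) :
    balancedWeight K S Y b = 1 := if_pos hb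

theorem sum_balancedWeight {S : Finset A} {Y : Set A} (hSY : ¬ (S : Set A) ⊆ Y)
    (hcard : ∀ T : Finset A, T.Nonempty → (T.card : K) ≠ 0) :
    ∑ b ∈ S, balancedWeight K S Y b = 0 := by
  classical
  obtain ⟨b, hbS, hbY⟩ := not_subset.1 hSY
  have hne : ((S.filter (· ∉ Y)).card : K) ≠ 0 := hcard _ ⟨b, Finset.mem_filter.2 ⟨hbS, hbY⟩⟩
  simp only [balancedWeight, Finset.sum_ite, Finset.sum_const, nsmul_eq_mul]
  field_simp
  ring

theorem balancedWeight_equiv {S S' : Finset A} {Y Y' : Set A} (e : Equiv.Perm A)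
    (hS : ∀ b, e b ∈ S' ↔ b ∈ S) (hY : ∀ b, e b ∈ Y' ↔ b ∈ Y) (b : A) :
    balancedWeight K S' Y' (e b) = balancedWeight K S Y b := by
  classical
  have hin : (S'.filter (· ∈ Y')).card = (S.filter (· ∈ Y)).card :=
    (Finset.card_equiv e fun b => by simp [hS, hY]).symm
  have hout : (S'.filter (· ∉ Y')).card = (S.filter (· ∉ Y)).card :=
    (Finset.card_equiv e fun b => by simp [hS, hY]).symm
  simp only [balancedWeight, hY, hin, hout]

theorem eq_of_forall_add_eq_of_sum_eq_zero {S : Finset A} {τ : A → K} {x y : K}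
    (hcard : (S.card : K) ≠ 0) (hτ : ∑ b ∈ S, τ b = 0) (h : ∀ b ∈ S, x + τ b = y) : x = y := by
  have hsum : S.card • x = S.card • y := by
    rw [← Finset.sum_const, ← Finset.sum_const, ← Finset.sum_congr rfl h, Finset.sum_add_distrib,
      hτ, add_zero]
  simpa [hcard] using hsum

end balancedWeight

section correction

variable {G A Q K : Type*} [Group G] [MulAction G Q] [Field K]

/-- A change of labels which turns the label `μ` of the points in `Y` back into `μ` after `θ` has
been applied. -/
noncomputable def correction (supp : Q → Finset A) (μ : Q → K) (θ : G) (Y : Set A) (b : A)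
    (q : Q) : K :=
  balancedWeight K (supp q) Y b * (μ q - μ (θ⁻¹ • q))

theorem sum_correction {supp : Q → Finset A} {μ : Q → K} {θ : G} {Y : Set A}
    (hcard : ∀ T : Finset A, T.Nonempty → (T.card : K) ≠ 0)
    (hμ : ∀ q, (supp q : Set A) ⊆ Y → μ q = μ (θ⁻¹ • q)) (q : Q) :
    ∑ b ∈ supp q, correction supp μ θ Y b q = 0 := by
  simp only [correction, ← Finset.sum_mul]
  by_cases hq : (supp q : Set A) ⊆ Y
  · rw [hμ q hq, sub_self, mul_zero]
  · rw [sum_balancedWeight hq hcard, zero_mul]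

variable [MulAction G A]

theorem twistedPerm_correction_apply (supp : Q → Finset A) (μ : Q → K) (θ : G) {Y : Set A} {a : A}
    (ha : θ • a ∈ Y) : twistedPerm θ (correction supp μ θ Y) (a, μ) = (θ • a, μ) := by
  simp [twistedPerm_apply, correction, balancedWeight_of_mem _ ha]

theorem twistedPerm_correction_mul {supp : Q → Finset A}
    (hsupp : ∀ (θ : G) (q : Q) (b : A), θ • b ∈ supp (θ • q) ↔ b ∈ supp q) (μ : Q → K)
    {θ θ' : G} {Y Y' : Set A} (hY : ∀ b, θ' • b ∈ Y' ↔ b ∈ Y) :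
    twistedPerm θ' (correction supp μ θ' Y') * twistedPerm θ (correction supp μ θ Y) =
      twistedPerm (θ' * θ) (correction supp μ (θ' * θ) Y') := by
  rw [twistedPerm_mul]
  congr 1
  ext b q
  have hweight : balancedWeight K (supp (θ'⁻¹ • q)) Y (θ'⁻¹ • b) =
      balancedWeight K (supp q) Y' b :=
    balancedWeight_equiv (MulAction.toPerm θ'⁻¹) (hsupp θ'⁻¹ q)
      (fun b => by rw [← hY, MulAction.toPerm_apply, smul_inv_smul]) b
  simp only [correction, hweight, mul_inv_rev, mul_smul]
  ring

end correction

section extensionSystem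

variable {L : FirstOrder.Language.{u, v}} {A : Type w}

/-- A copy `emb` of the vertices of `M` in a set `X`, a group of permutations of `X` with language
parts in `Γ` which preserves the relations and functions of `M` wherever it maps vertices of `M` to
vertices of `M`, and a coherent choice of members of this group extending the partial automorphisms
of `M`. -/
structure ExtensionSystem (Γ : Subgroup (LangPerm L)) (M : GStr L A) (X : Type*) where
  grp : Subgroup (Γ × Equiv.Perm X)
  emb : A → X
  emb_injective : Function.Injective emb
  holds_smul_iff : ∀ γ ∈ grp, ∀ (σ : Equiv.Perm A) (s : Slot L A),
    (∀ a ∈ s.vertices, γ • emb a = emb (σ a)) → (((γ.1, σ) • s).Holds M ↔ s.Holds M)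
  smul_core : ∀ γ ∈ grp, γ • emb '' M.core = emb '' M.core
  lift : Γ → SetRel A A → Equiv.Perm X
  lift_mem : ∀ {g : Γ} {r : SetRel A A}, IsPartialIso M g r → (g, lift g r) ∈ grp
  lift_apply : ∀ {g : Γ} {r : SetRel A A}, IsPartialIso M g r → ∀ {a b : A}, a ~[r] b →
    lift g r (emb a) = emb b
  lift_comp : ∀ {g g' : Γ} {r r' : SetRel A A}, IsPartialIso M g r → IsPartialIso M g' r' →
    r.cod = r'.dom → lift (g' * g) (r ○ r') = lift g' r' * lift g r

end extensionSystem

section averaging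

theorem indicator_one_eq_iff {Q K : Type*} [MulZeroOneClass K] [Nontrivial K] {S : Set Q}
    {q q' : Q} : S.indicator (1 : Q → K) q = S.indicator 1 q' ↔ (q ∈ S ↔ q' ∈ S) := by
  by_cases hq : q ∈ S <;> by_cases hq' : q' ∈ S <;> simp [hq, hq']

variable {L : FirstOrder.Language.{u, v}} {A : Type w} {Γ : Subgroup (LangPerm L)}
  {M : GStr L A} {Q : Type*} [MulAction (Γ × Equiv.Perm A) Q]

theorem IsPartialIso.image_core {g : LangPerm L} {r : SetRel A A} (hr : IsPartialIso M g r)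
    {σ : Equiv.Perm A} (hσ : ∀ a b, a ~[r] b → σ a = b) : σ '' M.core = M.core := by
  ext b
  constructor
  · rintro ⟨a, ha, rfl⟩
    obtain ⟨b, hab⟩ := GStr.core_subset hr.dom_closed ha
    rw [hσ a b hab]
    exact (hr.mem_core_iff hab).1 ha
  · intro hb
    obtain ⟨a, hab⟩ := GStr.core_subset hr.cod_closed hb
    exact ⟨a, (hr.mem_core_iff hab).2 hb, hσ a b hab⟩

namespace SlotCoding

variable (c : SlotCoding Γ M Q)

theorem coe_supp_smul (θ : Γ × Equiv.Perm A) (q : Q) :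
    (c.supp (θ • q) : Set A) = θ • (c.supp q : Set A) := by
  obtain ⟨s, rfl⟩ := c.surjective q
  rw [← map_smul, c.coe_supp, c.coe_supp, s.vertices_smul]

theorem smul_mem_supp_iff (θ : Γ × Equiv.Perm A) (q : Q) (b : A) :
    θ • b ∈ c.supp (θ • q) ↔ b ∈ c.supp q := by
  rw [← Finset.mem_coe, c.coe_supp_smul, smul_mem_smul_set_iff, Finset.mem_coe]

theorem supp_smul_eq_empty_iff (θ : Γ × Equiv.Perm A) (q : Q) :
    c.supp (θ • q) = ∅ ↔ c.supp q = ∅ := by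
  rw [← Finset.coe_eq_empty, c.coe_supp_smul, smul_set_eq_empty, Finset.coe_eq_empty]

theorem mem_marked_iff_of_isPartialIso {g : Γ} {r : SetRel A A} (hr : IsPartialIso M g r)
    {σ : Equiv.Perm A} (hσ : ∀ a b, a ~[r] b → σ a = b) {q : Q} (hq : (c.supp q : Set A) ⊆ r.dom) :
    ((g, σ) : Γ × Equiv.Perm A) • q ∈ c.marked ↔ q ∈ c.marked := by
  obtain ⟨s, rfl⟩ := c.surjective q
  rw [← map_smul, c.mem_marked, c.mem_marked]
  exact hr.holds_smul_iff hσ (by rwa [← c.coe_supp])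

/-- The copy of `A` in which all vertices are labelled by the indicator function of the set of
marked codes. -/
noncomputable def labelled (K : Type*) [Field K] (a : A) : A × (Q → K) :=
  (a, c.marked.indicator 1)

/-- The codes of slots without vertices which hold in `M`. No label can detect these. -/
def markedVertexFree : Set Q := {q | c.supp q = ∅ ∧ q ∈ c.marked}

/-- The permutations of the labelled vertices, with changes of labels of sum zero over the support
of each code, which preserve the core of `M` and the behaviour of `M` on slots without vertices. -/
noncomputable def averagedGrp (K : Type*) [Field K] : Subgroup (Γ × Equiv.Perm (A × (Q → K))) :=
  (twistedGroup c.supp c.smul_mem_supp_iff ⊓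
      (MulAction.stabilizer (Γ × Equiv.Perm A) c.markedVertexFree).comap (MonoidHom.fst _ _)).map
    ((MonoidHom.fst Γ (Equiv.Perm A)).prodMap (MonoidHom.id _)) ⊓
  MulAction.stabilizer _ (c.labelled K '' M.core)

variable {c} {K : Type*} [Field K]

theorem mem_averagedGrp {γ : Γ × Equiv.Perm (A × (Q → K))} :
    γ ∈ c.averagedGrp K ↔
      (∃ (σ : Equiv.Perm A) (τ : A → Q → K), (∀ q, ∑ b ∈ c.supp q, τ b q = 0) ∧
        γ.2 = twistedPerm ((γ.1, σ) : Γ × Equiv.Perm A) τ ∧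
        ((γ.1, σ) : Γ × Equiv.Perm A) • c.markedVertexFree = c.markedVertexFree) ∧
      γ • c.labelled K '' M.core = c.labelled K '' M.core := by
  obtain ⟨g, π⟩ := γ
  refine and_congr ⟨?_, ?_⟩ Iff.rfl
  · rintro ⟨⟨⟨g, σ⟩, π⟩, ⟨⟨τ, hτ, hπ⟩, hfree⟩, h⟩
    obtain ⟨rfl, rfl⟩ := Prod.ext_iff.1 h
    exact ⟨σ, τ, hτ, hπ, hfree⟩
  · rintro ⟨σ, τ, hτ, hπ, hfree⟩
    exact ⟨((g, σ), π), ⟨⟨τ, hτ, hπ⟩, hfree⟩, rfl⟩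

theorem holds_smul_iff_of_mem_averagedGrp
    (hcard : ∀ T : Finset A, T.Nonempty → (T.card : K) ≠ 0)
    {γ : Γ × Equiv.Perm (A × (Q → K))} (hγ : γ ∈ c.averagedGrp K) {σ : Equiv.Perm A} {s : Slot L A}
    (hs : ∀ a ∈ s.vertices, γ • c.labelled K a = c.labelled K (σ a)) :
    ((γ.1, σ) • s).Holds M ↔ s.Holds M := by
  obtain ⟨⟨ρ, τ, hτ, hγτ, hfree⟩, -⟩ := mem_averagedGrp.1 hγ
  set θ : Γ × Equiv.Perm A := (γ.1, ρ)
  have hlabel : ∀ a ∈ s.vertices, ρ a = σ a ∧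
      ∀ q, c.marked.indicator 1 (θ⁻¹ • q) + τ (ρ a) q = c.marked.indicator (1 : Q → K) q := by
    intro a ha
    have h := hs a ha
    rw [permProd_smul_def, hγτ, labelled, labelled, twistedPerm_apply, Prod.mk.injEq] at h
    exact ⟨h.1, congrFun h.2⟩
  rw [Slot.smul_congr fun a ha => (hlabel a ha).1.symm, ← c.mem_marked, ← c.mem_marked, map_smul]
  rcases (c.supp (θ • c.code s)).eq_empty_or_nonempty with hempty | hne
  · have h := smul_mem_smul_set_iff (a := θ) (s := c.markedVertexFree) (x := c.code s)
    rw [hfree] at h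
    simpa [markedVertexFree, hempty, (c.supp_smul_eq_empty_iff θ _).1 hempty] using h
  · refine (indicator_one_eq_iff.1 (eq_of_forall_add_eq_of_sum_eq_zero (hcard _ hne)
      (hτ (θ • c.code s)) fun b hb => ?_)).symm
    rw [← map_smul, ← Finset.mem_coe, c.coe_supp, s.vertices_smul] at hb
    obtain ⟨a, ha, rfl⟩ := hb
    have h := (hlabel a ha).2 (θ • c.code s)
    rwa [inv_smul_smul] at h

theorem smul_markedVertexFree {g : Γ} {r : SetRel A A} (hr : IsPartialIso M g r)
    {σ : Equiv.Perm A} (hσ : ∀ a b, a ~[r] b → σ a = b) :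
    ((g, σ) : Γ × Equiv.Perm A) • c.markedVertexFree = c.markedVertexFree := by
  set θ : Γ × Equiv.Perm A := (g, σ)
  have hiff : ∀ q, θ • q ∈ c.markedVertexFree ↔ q ∈ c.markedVertexFree := fun q => by
    rw [markedVertexFree, mem_ofPred_eq, mem_ofPred_eq, c.supp_smul_eq_empty_iff]
    exact and_congr_right fun hq => c.mem_marked_iff_of_isPartialIso hr hσ (by simp [hq])
  ext q
  rw [mem_smul_set_iff_inv_smul_mem, ← hiff, smul_inv_smul]

section system

variable [LinearOrder A] [Finite A]

variable (c K) in
/-- The coherent extension to labelled vertices of a partial automorphism with language part `g` and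
graph `r`. -/
noncomputable def averagedLift (g : Γ) (r : SetRel A A) : Equiv.Perm (A × (Q → K)) :=
  twistedPerm ((g, coherentExt r) : Γ × Equiv.Perm A)
    (correction c.supp (c.marked.indicator 1) (g, coherentExt r) r.cod)

theorem averagedLift_apply {g : Γ} {r : SetRel A A} (hr : IsPartialBij r) {a b : A}
    (hab : a ~[r] b) : c.averagedLift K g r (c.labelled K a) = c.labelled K b := by
  have h : ((g, coherentExt r) : Γ × Equiv.Perm A) • a = b := coherentExt_apply hr hab
  rw [averagedLift, labelled, twistedPerm_correction_apply _ _ _ (by rw [h]; exact ⟨a, hab⟩), h]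
  rfl

theorem averagedLift_comp {g g' : Γ} {r r' : SetRel A A} (hr : IsPartialBij r)
    (hr' : IsPartialBij r') (h : r.cod = r'.dom) :
    c.averagedLift K (g' * g) (r ○ r') = c.averagedLift K g' r' * c.averagedLift K g r := by
  rw [averagedLift, averagedLift, averagedLift,
    twistedPerm_correction_mul c.smul_mem_supp_iff (Y' := r'.cod), coherentExt_comp hr hr' h,
    cod_comp_of_cod_eq_dom h, Prod.mk_mul_mk]
  intro b
  rw [h, ← image_dom_eq_cod hr'.isMonotoneExtension_coherentExt.apply_eq]
  exact (coherentExt r').injective.mem_set_image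

theorem averagedLift_mem (hcard : ∀ T : Finset A, T.Nonempty → (T.card : K) ≠ 0)
    {g : Γ} {r : SetRel A A} (hr : IsPartialIso M g r) :
    (g, c.averagedLift K g r) ∈ c.averagedGrp K := by
  have hσ : ∀ a b, a ~[r] b → coherentExt r a = b :=
    fun a b hab => coherentExt_apply hr.isPartialBij hab
  set θ : Γ × Equiv.Perm A := (g, coherentExt r)
  refine mem_averagedGrp.2 ⟨⟨coherentExt r, _, sum_correction hcard fun q hq => ?_, rfl,
    smul_markedVertexFree hr hσ⟩, ?_⟩
  · have hq' : (c.supp (θ⁻¹ • q) : Set A) ⊆ r.dom := by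
      rw [c.coe_supp_smul, ← subset_smul_set_iff]
      exact hq.trans (image_dom_eq_cod hσ).superset
    rw [indicator_one_eq_iff, ← c.mem_marked_iff_of_isPartialIso hr hσ hq', smul_inv_smul]
  · have hcore : ∀ a ∈ M.core, c.averagedLift K g r (c.labelled K a) =
        c.labelled K (coherentExt r a) := by
      intro a ha
      obtain ⟨b, hab⟩ := GStr.core_subset hr.dom_closed ha
      rw [hσ a b hab, averagedLift_apply hr.isPartialBij hab]
    calc c.averagedLift K g r '' (c.labelled K '' M.core)
        = c.labelled K '' (coherentExt r '' M.core) := by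
          rw [image_image, image_image]
          exact image_congr hcore
      _ = c.labelled K '' M.core := by rw [hr.image_core hσ]

/-- The averaging construction: since a change of labels has sum zero over the support of a code,
a permutation which restores the labels of all vertices of the support of a code cannot change
whether the code is marked. -/
noncomputable def averagedSystem (c : SlotCoding Γ M Q)
    (hcard : ∀ T : Finset A, T.Nonempty → (T.card : K) ≠ 0) :
    ExtensionSystem Γ M (A × (Q → K)) where
  grp := c.averagedGrp K
  emb := c.labelled K
  emb_injective _ _ h := congrArg Prod.fst h
  holds_smul_iff _ hγ _ _ hs := holds_smul_iff_of_mem_averagedGrp hcard hγ hs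
  smul_core _ hγ := (mem_averagedGrp.1 hγ).2
  lift := c.averagedLift K
  lift_mem := averagedLift_mem hcard
  lift_apply hr _ _ hab := averagedLift_apply hr.isPartialBij hab
  lift_comp hr hr' h := averagedLift_comp hr.isPartialBij hr'.isPartialBij h

end system

end SlotCoding

theorem exists_extensionSystem [Finite A] (horbit : (M.relabelOrbit Γ).Finite) :
    ∃ (n p : ℕ) (_ : NeZero p), Nonempty (ExtensionSystem Γ M (A × (Fin n → ZMod p))) := by
  classical
  obtain ⟨n, _, ⟨c⟩⟩ := exists_slotCoding horbit
  obtain ⟨p, hp, hprime⟩ := Nat.exists_infinite_primes (Nat.card A + 1)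
  have : Fact p.Prime := ⟨hprime⟩
  have := linearOrderOfSTO (WellOrderingRel (α := A))
  have := Fintype.ofFinite A
  refine ⟨n, p, inferInstance, ⟨c.averagedSystem (K := ZMod p) fun T hT => ?_⟩⟩
  rw [Ne, ZMod.natCast_eq_zero_iff]
  refine Nat.not_dvd_of_pos_of_lt hT.card_pos (lt_of_le_of_lt ?_ hp)
  rw [Nat.card_eq_fintype_card]
  exact T.card_le_univ

end averaging

section colouring

variable {L : FirstOrder.Language.{u, v}} {A : Type w} {Γ : Subgroup (LangPerm L)} {M : GStr L A}
  {X : Type w'}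

/-- The pairs of an element of `H` and a permutation of `Y` which lift a member of `K` along `p`. -/
def liftGrp {H Y X : Type*} [Group H] (K : Subgroup (H × Equiv.Perm X)) (p : Y → X) :
    Subgroup (H × Equiv.Perm Y) where
  carrier := {δ | ∃ γ ∈ K, δ.1 = γ.1 ∧ ∀ v, p (δ • v) = γ • p v}
  one_mem' := ⟨1, K.one_mem, rfl, fun _ => rfl⟩
  mul_mem' := by
    rintro δ δ' ⟨γ, hγ, hfst, hp⟩ ⟨γ', hγ', hfst', hp'⟩
    refine ⟨γ * γ', K.mul_mem hγ hγ', congrArg₂ _ hfst hfst', fun v => ?_⟩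
    rw [mul_smul, mul_smul, hp, hp']
  inv_mem' := by
    rintro δ ⟨γ, hγ, hfst, hp⟩
    refine ⟨γ⁻¹, K.inv_mem hγ, congrArg _ hfst, fun v => ?_⟩
    rw [eq_inv_smul_iff, ← hp, smul_inv_smul]

namespace ExtensionSystem

variable (S : ExtensionSystem Γ M X)

/-- Some member of the group maps `C` into the copy of the vertices of `M`. -/
def MapsIn (C : Set X) : Prop := ∃ γ ∈ S.grp, γ • C ⊆ range S.emb

/-- A set can be mapped into the copy of the vertices of `M` as soon as each two of its elements
can. -/
def IsTwoDetermined : Prop :=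
  ∀ C : Set X, (∀ x ∈ C, ∀ y ∈ C, S.MapsIn {x, y}) → S.MapsIn C

/-- Sets of `k + 2` elements, none of them in the core, which cannot be mapped into the copy of the
vertices of `M`. -/
structure Bad (k : ℕ) (U : Set X) : Prop where
  ncard_eq : U.ncard = k + 2
  disjoint_core : Disjoint U (S.emb '' M.core)
  not_mapsIn : ¬ S.MapsIn U

variable {S}

theorem mapsIn_smul_iff {γ : Γ × Equiv.Perm X} (hγ : γ ∈ S.grp) {C : Set X} :
    S.MapsIn (γ • C) ↔ S.MapsIn C := by
  constructor
  · rintro ⟨δ, hδ, h⟩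
    exact ⟨δ * γ, S.grp.mul_mem hδ hγ, by rwa [mul_smul]⟩
  · rintro ⟨δ, hδ, h⟩
    exact ⟨δ * γ⁻¹, S.grp.mul_mem hδ (S.grp.inv_mem hγ), by rwa [mul_smul, inv_smul_smul]⟩

theorem bad_smul_iff {γ : Γ × Equiv.Perm X} (hγ : γ ∈ S.grp) {k : ℕ} {U : Set X} :
    S.Bad k (γ • U) ↔ S.Bad k U := by
  have hcore : Disjoint (γ • U) (S.emb '' M.core) ↔ Disjoint U (S.emb '' M.core) := by
    conv_lhs => rw [← S.smul_core γ hγ]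
    exact disjoint_smul_set
  constructor
  · rintro ⟨hcard, hdisj, hmaps⟩
    exact ⟨by rwa [ncard_smul_set] at hcard, hcore.1 hdisj, by rwa [mapsIn_smul_iff hγ] at hmaps⟩
  · rintro ⟨hcard, hdisj, hmaps⟩
    exact ⟨by rwa [ncard_smul_set], hcore.2 hdisj, by rwa [mapsIn_smul_iff hγ]⟩

theorem mapsIn_of_forall_not_bad [Finite X] {U : Set X} (hcore : Disjoint U (S.emb '' M.core))
    (hU : ∀ k, ¬ S.Bad k U) (hsingle : ∀ x ∈ U, S.MapsIn {x}) : S.MapsIn U := by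
  by_contra hmaps
  rcases h : U.ncard with _ | _ | k
  · exact hmaps ⟨1, S.grp.one_mem, by simp [(ncard_eq_zero).1 h]⟩
  · obtain ⟨x, rfl⟩ := ncard_eq_one.1 h
    exact hmaps (hsingle x rfl)
  · exact hU k ⟨h, hcore, hmaps⟩

variable (S)

/-- As a bad set is not contained in the copy of the vertices of `M`, fewer colours than it has
elements suffice for the vertices of `M` in it. -/
theorem exists_colouring [Finite A] (k : ℕ) (U : Set X) :
    ∃ col : A → Fin (k + 1), (S.Bad k U → InjOn col (S.emb ⁻¹' U)) ∧
      ∀ a, ¬ (S.Bad k U ∧ S.emb a ∈ U) → col a = 0 := by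
  classical
  by_cases hU : S.Bad k U
  · have hlt : (S.emb ⁻¹' U).ncard < U.ncard := by
      rw [← ncard_image_of_injective _ S.emb_injective, image_preimage_eq_inter_range]
      refine ncard_lt_ncard (inter_ssubset_left_iff.2 fun h => hU.not_mapsIn ?_)
        (finite_of_ncard_pos (by rw [hU.ncard_eq]; omega))
      exact ⟨1, S.grp.one_mem, by rwa [one_smul]⟩
    have hcard : (S.emb ⁻¹' U).encard ≤ (univ : Set (Fin (k + 1))).encard := by
      rw [← (toFinite (S.emb ⁻¹' U)).cast_ncard_eq, ← (toFinite univ).cast_ncard_eq,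
        ncard_univ, Nat.card_fin, Nat.cast_le]
      have := hU.ncard_eq
      omega
    obtain ⟨f, -, hf⟩ := (toFinite _).exists_injOn_of_encard_le hcard
    refine ⟨fun a => if S.emb a ∈ U then f a else 0, fun _ a ha b hb hab => ?_,
      fun a ha => if_neg fun h => ha ⟨hU, h⟩⟩
    exact hf ha hb (by simpa [mem_preimage.1 ha, mem_preimage.1 hb] using hab)
  · exact ⟨fun _ => 0, fun h => absurd h hU, fun _ _ => rfl⟩

/-- The colours of the vertices of `M` at the set `U`, which are distinct if `U` is bad. -/
noncomputable def colour [Finite A] (a : A) (k : ℕ) (U : Set X) : Fin (k + 1) :=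
  (S.exists_colouring k U).choose a

/-- Points of `X` together with a colour for each set. Only the colours at bad sets with `k + 2`
elements, at which `k + 1` colours are available, matter. -/
abbrev Coloured (X : Type w') : Type w' :=
  X × (∀ k : Fin (Nat.card X), Set X → Fin ((k : ℕ) + 1))

/-- The copy of the vertices of `M` in the coloured points. -/
noncomputable def embColoured [Finite A] (a : A) : Coloured X :=
  (S.emb a, fun k U => S.colour a k U)

/-- Only the bad sets which contain the point have a nonzero colour. -/
def Normal (u : Coloured X) : Prop :=
  ∀ (k : Fin (Nat.card X)) (U : Set X), ¬ (S.Bad k U ∧ u.1 ∈ U) → u.2 k U = 0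

/-- Two normal coloured points are generic if they have distinct colours at each bad set that
contains them both. Distinct coloured points over the same point are not generic. -/
structure Generic (u v : Coloured X) : Prop where
  normal_left : S.Normal u
  normal_right : S.Normal v
  eq : u.1 = v.1 → u = v
  colour_ne : ∀ (k : Fin (Nat.card X)) (U : Set X), S.Bad k U → u.1 ∈ U → v.1 ∈ U → u.1 ≠ v.1 →
    u.2 k U ≠ v.2 k U

variable {S}

theorem colour_injOn [Finite A] {k : ℕ} {U : Set X} (hU : S.Bad k U) {a b : A} (ha : S.emb a ∈ U)
    (hb : S.emb b ∈ U) (h : S.colour a k U = S.colour b k U) : a = b :=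
  (S.exists_colouring k U).choose_spec.1 hU ha hb h

theorem colour_eq_zero [Finite A] {k : ℕ} {U : Set X} {a : A} (h : ¬ (S.Bad k U ∧ S.emb a ∈ U)) :
    S.colour a k U = 0 :=
  (S.exists_colouring k U).choose_spec.2 a h

theorem generic_embColoured [Finite A] (a b : A) :
    S.Generic (S.embColoured a) (S.embColoured b) where
  normal_left _ _ := colour_eq_zero
  normal_right _ _ := colour_eq_zero
  eq h := by rw [S.emb_injective h]
  colour_ne _ _ hU ha hb hab h := hab (congrArg S.emb (colour_injOn hU ha hb h))

theorem generic_of_mem_image_embColoured [Finite A] {B : Set A} {u v : Coloured X}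
    (hu : u ∈ S.embColoured '' B) (hv : v ∈ S.embColoured '' B) : S.Generic u v := by
  obtain ⟨⟨a, -, rfl⟩, ⟨b, -, rfl⟩⟩ := And.intro hu hv
  exact generic_embColoured a b

theorem not_bad_of_generic [Finite X] {C : Set (Coloured X)}
    (hC : ∀ u ∈ C, ∀ v ∈ C, S.Generic u v) {U : Set X} (hU : U ⊆ Prod.fst '' C) (k : ℕ) :
    ¬ S.Bad k U := by
  intro hbad
  have hk : k < Nat.card X := by
    have := ncard_le_card U
    have := hbad.ncard_eq
    omega
  choose! f hfC hf using fun x (hx : x ∈ U) => hU hx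
  let col (x : X) : Fin (k + 1) := (f x).2 ⟨k, hk⟩ U
  have hinj : InjOn col U := by
    intro x hx y hy hxy
    by_contra hne
    refine (hC (f x) (hfC x hx) (f y) (hfC y hy)).colour_ne ⟨k, hk⟩ U hbad ?_ ?_ ?_ hxy
    all_goals simpa only [hf x hx, hf y hy]
  have hle := ncard_le_ncard_of_injOn (t := univ) _ (fun _ _ => mem_univ _) hinj
  rw [hbad.ncard_eq, ncard_univ, Nat.card_fin] at hle
  omega

section recolour

variable [Finite A]

/-- The colour changes at `U` which are needed for mapping each `v ∈ D` with `γ • v.1 = S.emb a` to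
`S.embColoured a`. -/
def colourRel (S : ExtensionSystem Γ M X) (γ : Γ × Equiv.Perm X) (D : Set (Coloured X))
    (k : Fin (Nat.card X)) (U : Set X) : SetRel (Fin ((k : ℕ) + 1)) (Fin ((k : ℕ) + 1)) :=
  {p | ∃ v ∈ D, ∃ a, γ • v.1 = S.emb a ∧ S.emb a ∈ U ∧ p = (v.2 k (γ⁻¹ • U), S.colour a k U)}

open Classical in
/-- The permutation of the colours at `U` of the points over `x`. -/
noncomputable def colourPerm (S : ExtensionSystem Γ M X) (γ : Γ × Equiv.Perm X)
    (D : Set (Coloured X)) (k : Fin (Nat.card X)) (U : Set X) (x : X) :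
    Equiv.Perm (Fin ((k : ℕ) + 1)) :=
  if S.Bad k U ∧ x ∈ U then coherentExt (S.colourRel γ D k U) else 1

/-- The action of `γ` on points, followed by permutations of the colours at bad sets, which maps
`v ∈ D` to `S.embColoured a` if `γ • v.1 = S.emb a`. -/
noncomputable def recolour (S : ExtensionSystem Γ M X) (γ : Γ × Equiv.Perm X)
    (D : Set (Coloured X)) : Equiv.Perm (Coloured X) where
  toFun v := (γ • v.1, fun k U => S.colourPerm γ D k U (γ • v.1) (v.2 k (γ⁻¹ • U)))
  invFun v := (γ⁻¹ • v.1, fun k U => (S.colourPerm γ D k (γ • U) v.1).symm (v.2 k (γ • U)))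
  left_inv v := by simp
  right_inv v := by simp

variable {γ : Γ × Equiv.Perm X} {D : Set (Coloured X)}

theorem colourPerm_of_not {k : Fin (Nat.card X)} {U : Set X} {x : X} (h : ¬ (S.Bad k U ∧ x ∈ U)) :
    S.colourPerm γ D k U x = 1 := if_neg h

theorem colourPerm_of_bad {k : Fin (Nat.card X)} {U : Set X} {x : X} (h : S.Bad k U) (hx : x ∈ U) :
    S.colourPerm γ D k U x = coherentExt (S.colourRel γ D k U) := if_pos ⟨h, hx⟩

theorem recolour_smul_snd (v : Coloured X) (k : Fin (Nat.card X)) (U : Set X) :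
    (S.recolour γ D v).2 k (γ • U) = S.colourPerm γ D k (γ • U) (γ • v.1) (v.2 k U) := by
  change S.colourPerm γ D k (γ • U) (γ • v.1) (v.2 k (γ⁻¹ • γ • U)) = _
  rw [inv_smul_smul]

theorem isPartialBij_colourRel (hγ : γ ∈ S.grp) (hD : ∀ u ∈ D, ∀ v ∈ D, S.Generic u v)
    {k : Fin (Nat.card X)} {U : Set X} (hU : S.Bad k U) : IsPartialBij (S.colourRel γ D k U) := by
  constructor
  · rintro _ _ _ ⟨v, hv, a, hva, ha, h⟩ ⟨v', hv', a', hva', ha', h'⟩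
    obtain ⟨rfl, rfl⟩ := Prod.ext_iff.1 h
    obtain ⟨rfl, hcol⟩ := Prod.ext_iff.1 h'
    obtain rfl := colour_injOn hU ha ha' hcol
    rw [(hD v hv v' hv').eq ((MulAction.injective γ) (hva.trans hva'.symm))]
  · rintro _ _ _ ⟨v, hv, a, hva, ha, h⟩ ⟨v', hv', a', hva', ha', h'⟩
    obtain ⟨rfl, rfl⟩ := Prod.ext_iff.1 h
    obtain ⟨hcol, rfl⟩ := Prod.ext_iff.1 h'
    by_cases hvv' : v.1 = v'.1
    · rw [S.emb_injective (hva.symm.trans ((congrArg (γ • ·) hvv').trans hva'))]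
    · refine absurd hcol ((hD v hv v' hv').colour_ne k _
        ((bad_smul_iff (S.grp.inv_mem hγ)).2 hU) ?_ ?_ hvv')
      · rwa [mem_inv_smul_set_iff, hva]
      · rwa [mem_inv_smul_set_iff, hva']

theorem recolour_apply (hγ : γ ∈ S.grp) (hD : ∀ u ∈ D, ∀ v ∈ D, S.Generic u v) {v : Coloured X}
    (hv : v ∈ D) {a : A} (hva : γ • v.1 = S.emb a) : S.recolour γ D v = S.embColoured a := by
  refine Prod.ext hva (funext₂ fun k U => ?_)
  change S.colourPerm γ D k U (γ • v.1) (v.2 k (γ⁻¹ • U)) = S.colour a k U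
  rw [hva]
  by_cases hU : S.Bad k U ∧ S.emb a ∈ U
  · rw [colourPerm_of_bad hU.1 hU.2]
    exact coherentExt_apply (isPartialBij_colourRel hγ hD hU.1) ⟨v, hv, a, hva, hU.2, rfl⟩
  · rw [colourPerm_of_not hU, Equiv.Perm.one_apply, colour_eq_zero hU]
    refine (hD v hv v hv).normal_left k _ ?_
    rwa [bad_smul_iff (S.grp.inv_mem hγ), mem_inv_smul_set_iff, hva]

theorem normal_recolour_iff (hγ : γ ∈ S.grp) (u : Coloured X) :
    S.Normal (S.recolour γ D u) ↔ S.Normal u := by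
  refine forall_congr' fun k => (MulAction.surjective γ).forall.trans (forall_congr' fun U => ?_)
  change (¬ (_ ∧ γ • u.1 ∈ _) → _) ↔ _
  rw [bad_smul_iff hγ, smul_mem_smul_set_iff, recolour_smul_snd]
  refine imp_congr_right fun h => ?_
  rw [colourPerm_of_not (by rwa [bad_smul_iff hγ, smul_mem_smul_set_iff]), Equiv.Perm.one_apply]

theorem generic_recolour_iff (hγ : γ ∈ S.grp) (u v : Coloured X) :
    S.Generic (S.recolour γ D u) (S.recolour γ D v) ↔ S.Generic u v := by
  have hfst : ∀ w, (S.recolour γ D w).1 = γ • w.1 := fun _ => rfl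
  have heq : ((S.recolour γ D u).1 = (S.recolour γ D v).1 → S.recolour γ D u = S.recolour γ D v) ↔
      (u.1 = v.1 → u = v) := by
    rw [hfst, hfst, (MulAction.injective γ).eq_iff, (Equiv.injective _).eq_iff]
  have hcolour : (∀ (k : Fin (Nat.card X)) (U : Set X), S.Bad k U → (S.recolour γ D u).1 ∈ U →
        (S.recolour γ D v).1 ∈ U → (S.recolour γ D u).1 ≠ (S.recolour γ D v).1 →
        (S.recolour γ D u).2 k U ≠ (S.recolour γ D v).2 k U) ↔
      ∀ (k : Fin (Nat.card X)) (U : Set X), S.Bad k U → u.1 ∈ U → v.1 ∈ U → u.1 ≠ v.1 →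
        u.2 k U ≠ v.2 k U := by
    refine forall_congr' fun k => (MulAction.surjective γ).forall.trans (forall_congr' fun U => ?_)
    simp only [hfst, bad_smul_iff hγ, smul_mem_smul_set_iff, (MulAction.injective γ).ne_iff,
      recolour_smul_snd]
    refine imp_congr_right fun h => imp_congr_right fun hu => imp_congr_right fun hv => ?_
    have h' : S.Bad k (γ • U) := (bad_smul_iff hγ).2 h
    rw [colourPerm_of_bad h' (smul_mem_smul_set hu), colourPerm_of_bad h' (smul_mem_smul_set hv),
      (Equiv.injective _).ne_iff]
  constructor
  · rintro ⟨hu, hv, h, h'⟩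
    exact ⟨(normal_recolour_iff hγ u).1 hu, (normal_recolour_iff hγ v).1 hv, heq.1 h, hcolour.1 h'⟩
  · rintro ⟨hu, hv, h, h'⟩
    exact ⟨(normal_recolour_iff hγ u).2 hu, (normal_recolour_iff hγ v).2 hv, heq.2 h, hcolour.2 h'⟩

theorem recolour_embColoured_of_mem_core {a b : A} (ha : a ∈ M.core) (hb : b ∈ M.core)
    (hab : γ • S.emb a = S.emb b) :
    S.recolour γ D (S.embColoured a) = S.embColoured b := by
  have hzero : ∀ {a : A}, a ∈ M.core → ∀ {k U}, ¬ (S.Bad k U ∧ S.emb a ∈ U) := fun ha _ _ h =>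
    disjoint_left.1 h.1.disjoint_core h.2 (mem_image_of_mem _ ha)
  refine Prod.ext hab (funext₂ fun k U => ?_)
  change S.colourPerm γ D k U (γ • S.emb a) (S.colour a k (γ⁻¹ • U)) = S.colour b k U
  rw [hab, colourPerm_of_not (hzero hb), Equiv.Perm.one_apply, colour_eq_zero (hzero ha),
    colour_eq_zero (hzero hb)]

variable (S) in
/-- The permutations of the coloured points over a member of the group which preserve genericity and
the core. -/
noncomputable def colouredGrp : Subgroup (Γ × Equiv.Perm (Coloured X)) :=
  liftGrp S.grp Prod.fst ⊓
    MulAction.stabilizer _ {p : Coloured X × Coloured X | S.Generic p.1 p.2} ⊓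
    MulAction.stabilizer _ (S.embColoured '' M.core)

theorem generic_smul_iff {δ : Γ × Equiv.Perm (Coloured X)} (hδ : δ ∈ S.colouredGrp)
    {u v : Coloured X} : S.Generic (δ • u) (δ • v) ↔ S.Generic u v :=
  MulAction.mem_stabilizer_set.1 hδ.1.2 (u, v)

theorem recolour_mem {g : Γ} {π : Equiv.Perm X} (hπ : (g, π) ∈ S.grp) :
    (g, S.recolour (g, π) D) ∈ S.colouredGrp := by
  refine ⟨⟨⟨_, hπ, rfl, fun _ => rfl⟩, MulAction.mem_stabilizer_set.2 fun p =>
    generic_recolour_iff hπ p.1 p.2⟩, ?_⟩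
  refine (MulAction.mem_stabilizer_set_iff_smul_set_subset (toFinite _)).2 ?_
  rintro _ ⟨_, ⟨a, ha, rfl⟩, rfl⟩
  obtain ⟨b, hb, hab⟩ :=
    (S.smul_core _ hπ).subset (smul_mem_smul_set (mem_image_of_mem S.emb ha))
  exact ⟨b, hb, (recolour_embColoured_of_mem_core ha hb hab.symm).symm⟩

variable {γ' : Γ × Equiv.Perm X} {B : Set A}

theorem colourRel_mul (hB : γ • Prod.fst '' D = S.emb '' B) (hγ' : γ' ∈ S.grp)
    {k : Fin (Nat.card X)} {U : Set X} (hU : S.Bad k U) :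
    S.colourRel (γ' * γ) D k U =
      S.colourRel γ D k (γ'⁻¹ • U) ○ S.colourRel γ' (S.embColoured '' B) k U := by
  ext ⟨c, d⟩
  constructor
  · rintro ⟨v, hv, a, hva, ha, h⟩
    obtain ⟨b, hb, hvb⟩ := hB.subset (smul_mem_smul_set (mem_image_of_mem _ hv))
    have hba : γ' • S.emb b = S.emb a := by rw [hvb, ← mul_smul, hva]
    obtain ⟨rfl, rfl⟩ := Prod.ext_iff.1 h
    refine ⟨S.colour b k (γ'⁻¹ • U), ⟨v, hv, b, hvb.symm, ?_, ?_⟩, _, ⟨b, hb, rfl⟩, a, hba, ha, rfl⟩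
    · rwa [mem_inv_smul_set_iff, hba]
    · rw [mul_inv_rev, mul_smul]
  · rintro ⟨e, ⟨v, hv, b, hvb, hbU, h⟩, _, ⟨b', hb', rfl⟩, a, hba, ha, h'⟩
    obtain ⟨rfl, rfl⟩ := Prod.ext_iff.1 h
    obtain ⟨hcol, rfl⟩ := Prod.ext_iff.1 h'
    have hbU' : S.emb b' ∈ γ'⁻¹ • U := by
      rw [mem_inv_smul_set_iff]
      exact hba.symm ▸ ha
    obtain rfl := colour_injOn ((bad_smul_iff (S.grp.inv_mem hγ')).2 hU) hbU hbU' hcol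
    refine ⟨v, hv, a, ?_, ha, ?_⟩
    · rw [mul_smul, hvb]
      exact hba
    · rw [mul_inv_rev, mul_smul]

theorem cod_colourRel_eq_dom (hB : γ • Prod.fst '' D = S.emb '' B)
    (hB' : γ' • S.emb '' B ⊆ range S.emb) {k : Fin (Nat.card X)} {U : Set X} :
    (S.colourRel γ D k (γ'⁻¹ • U)).cod = (S.colourRel γ' (S.embColoured '' B) k U).dom := by
  ext d
  constructor
  · rintro ⟨_, v, hv, b, hvb, hbU, h⟩
    obtain ⟨b', hb', hvb'⟩ := hB.subset (smul_mem_smul_set (mem_image_of_mem _ hv))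
    obtain rfl := S.emb_injective (hvb.symm.trans hvb'.symm)
    obtain ⟨a, ha⟩ := hB' (smul_mem_smul_set (mem_image_of_mem _ hb'))
    obtain ⟨rfl, rfl⟩ := Prod.ext_iff.1 h
    exact ⟨_, _, ⟨b, hb', rfl⟩, a, ha.symm, ha ▸ mem_inv_smul_set_iff.1 hbU, rfl⟩
  · rintro ⟨_, _, ⟨b, hb, rfl⟩, a, hba, ha, h⟩
    obtain ⟨rfl, rfl⟩ := Prod.ext_iff.1 h
    obtain ⟨_, ⟨v, hv, rfl⟩, hvb⟩ := hB.superset (mem_image_of_mem _ hb)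
    exact ⟨_, v, hv, b, hvb, mem_inv_smul_set_iff.2 (hba ▸ ha), rfl⟩

theorem recolour_mul (hγ : γ ∈ S.grp) (hγ' : γ' ∈ S.grp) (hD : ∀ u ∈ D, ∀ v ∈ D, S.Generic u v)
    (hB : γ • Prod.fst '' D = S.emb '' B) (hB' : γ' • S.emb '' B ⊆ range S.emb) :
    S.recolour (γ' * γ) D = S.recolour γ' (S.embColoured '' B) * S.recolour γ D := by
  have hgen : ∀ u ∈ S.embColoured '' B, ∀ v ∈ S.embColoured '' B, S.Generic u v :=
    fun _ hu _ hv => generic_of_mem_image_embColoured hu hv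
  refine Equiv.ext fun v => Prod.ext (mul_smul γ' γ v.1) (funext₂ fun k U => ?_)
  change S.colourPerm (γ' * γ) D k U ((γ' * γ) • v.1) (v.2 k ((γ' * γ)⁻¹ • U)) =
    S.colourPerm γ' _ k U (γ' • γ • v.1) (S.colourPerm γ D k (γ'⁻¹ • U) (γ • v.1) (v.2 k _))
  rw [mul_inv_rev, mul_smul, mul_smul]
  have hbad : S.Bad k (γ'⁻¹ • U) ↔ S.Bad k U := bad_smul_iff (S.grp.inv_mem hγ')
  by_cases h : S.Bad k U ∧ γ' • γ • v.1 ∈ U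
  · rw [colourPerm_of_bad h.1 h.2, colourPerm_of_bad h.1 h.2,
      colourPerm_of_bad (hbad.2 h.1) (mem_inv_smul_set_iff.2 h.2), colourRel_mul hB hγ' h.1,
      coherentExt_comp (isPartialBij_colourRel hγ hD (hbad.2 h.1))
        (isPartialBij_colourRel hγ' hgen h.1) (cod_colourRel_eq_dom hB hB'), Equiv.Perm.mul_apply]
  · rw [colourPerm_of_not h, colourPerm_of_not h,
      colourPerm_of_not (by rwa [hbad, mem_inv_smul_set_iff])]
    rfl

end recolour

theorem smul_emb_image_dom (S : ExtensionSystem Γ M X) {g : Γ} {r : SetRel A A}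
    (hr : IsPartialIso M g r) : (g, S.lift g r) • S.emb '' r.dom = S.emb '' r.cod := by
  ext x
  constructor
  · rintro ⟨_, ⟨a, ⟨b, hab⟩, rfl⟩, rfl⟩
    exact ⟨b, ⟨a, hab⟩, (S.lift_apply hr hab).symm⟩
  · rintro ⟨b, ⟨a, hab⟩, rfl⟩
    exact ⟨_, ⟨a, ⟨b, hab⟩, rfl⟩, S.lift_apply hr hab⟩

/-- The extension system on the coloured points. -/
noncomputable def coloured [Finite A] (S : ExtensionSystem Γ M X) :
    ExtensionSystem Γ M (Coloured X) where
  grp := S.colouredGrp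
  emb := S.embColoured
  emb_injective _ _ h := S.emb_injective (congrArg Prod.fst h)
  holds_smul_iff := by
    rintro ⟨_, π⟩ ⟨⟨⟨γ, hγ, rfl, hπ⟩, -⟩, -⟩ σ s hσ
    exact S.holds_smul_iff γ hγ σ s fun a ha => (hπ _).symm.trans (congrArg Prod.fst (hσ a ha))
  smul_core _ hγ := hγ.2
  lift g r := S.recolour (g, S.lift g r) (S.embColoured '' r.dom)
  lift_mem hr := recolour_mem (S.lift_mem hr)
  lift_apply {_ _} hr {_ b} hab :=
    recolour_apply (S.lift_mem hr) (fun _ hu _ hv => generic_of_mem_image_embColoured hu hv)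
      (mem_image_of_mem S.embColoured (show _ ∈ SetRel.dom _ from ⟨b, hab⟩)) (S.lift_apply hr hab)
  lift_comp {g g' r r'} hr hr' h := by
    have hdom : (r ○ r').dom = r.dom := dom_comp_of_cod_eq_dom h
    rw [hdom, S.lift_comp hr hr' h, ← h]
    refine recolour_mul (S.lift_mem hr) (S.lift_mem hr')
      (fun _ hu _ hv => generic_of_mem_image_embColoured hu hv) ?_ ?_
    · rw [image_image]
      exact S.smul_emb_image_dom hr
    · rw [h, S.smul_emb_image_dom hr']
      exact image_subset_range _ _

theorem isTwoDetermined_coloured [Finite A] [Finite X] (S : ExtensionSystem Γ M X) :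
    S.coloured.IsTwoDetermined := by
  intro C hC
  have hgen : ∀ u ∈ C, ∀ v ∈ C, S.Generic u v := by
    intro u hu v hv
    obtain ⟨δ, hδ, hsub⟩ := hC u hu v hv
    obtain ⟨a, ha⟩ := hsub (smul_mem_smul_set (mem_insert _ _))
    obtain ⟨b, hb⟩ := hsub (smul_mem_smul_set (mem_insert_of_mem _ rfl))
    rw [← generic_smul_iff hδ, ← ha, ← hb]
    exact generic_embColoured a b
  have hsingle : ∀ u ∈ C, S.MapsIn {u.1} := by
    intro u hu
    obtain ⟨δ, ⟨⟨⟨γ, hγ, -, hδ⟩, -⟩, -⟩, hsub⟩ := hC u hu u hu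
    obtain ⟨a, ha⟩ := hsub (smul_mem_smul_set (mem_insert _ _))
    exact ⟨γ, hγ, smul_set_singleton.trans_subset (singleton_subset_iff.2
      ⟨a, (congrArg Prod.fst ha).trans (hδ u)⟩)⟩
  obtain ⟨γ, hγ, hsub⟩ : S.MapsIn (Prod.fst '' C \ S.emb '' M.core) := by
    refine mapsIn_of_forall_not_bad disjoint_sdiff_left
      (not_bad_of_generic hgen sdiff_subset) ?_
    rintro _ ⟨⟨u, hu, rfl⟩, -⟩
    exact hsingle u hu
  refine ⟨(γ.1, S.recolour γ C), recolour_mem hγ, ?_⟩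
  rintro _ ⟨u, hu, rfl⟩
  obtain ⟨a, ha⟩ : γ • u.1 ∈ range S.emb := by
    by_cases hcore : u.1 ∈ S.emb '' M.core
    · exact image_subset_range _ _ ((S.smul_core γ hγ).subset (smul_mem_smul_set hcore))
    · exact hsub (smul_mem_smul_set ⟨mem_image_of_mem _ hu, hcore⟩)
  exact ⟨a, (recolour_apply hγ hgen hu ha.symm).symm⟩

end ExtensionSystem

end colouring

section witness

variable {L : FirstOrder.Language.{u, v}} {A : Type w} {Γ : Subgroup (LangPerm L)} {M : GStr L A}
  {X : Type w'}

namespace ExtensionSystem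

variable (S : ExtensionSystem Γ M X)

/-- The language part of an element of the group. -/
def lang : S.grp →* LangPerm L :=
  Γ.subtype.comp ((MonoidHom.fst Γ (Equiv.Perm X)).comp S.grp.subtype)

theorem lang_mem (γ : S.grp) : S.lang γ ∈ Γ := γ.1.1.2

/-- A vertex of `M` together with the substructure which it generates. -/
def germ (a : A) : X × Set X := (S.emb a, S.emb '' M.closure {a})

/-- The vertices of the witness: the translates of the germs of the vertices of `M`. -/
def translates : SubMulAction S.grp (X × Set X) where
  carrier := {p | ∃ (γ : S.grp) (a : A), γ • S.germ a = p}
  smul_mem' := by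
    rintro δ _ ⟨γ, a, rfl⟩
    exact ⟨δ * γ, a, mul_smul _ _ _⟩

/-- The vertex of the witness which corresponds to a vertex of `M`. -/
def point (a : A) : S.translates := ⟨S.germ a, 1, a, one_smul _ _⟩

theorem point_injective : Function.Injective S.point := fun _ _ h =>
  S.emb_injective (congrArg (fun p => p.1.1) h)

theorem exists_smul_point_eq (x : S.translates) : ∃ (γ : S.grp) (a : A), γ • S.point a = x := by
  obtain ⟨_, γ, a, rfl⟩ := x
  exact ⟨γ, a, rfl⟩

/-- The union of the translates of `M`. -/
def witness : GStr L S.translates where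
  rel {n} R := {z | ∃ (γ : S.grp) (R₀ : L.Relations n), (S.lang γ).1 n R₀ = R ∧
    ∃ x ∈ M.rel R₀, γ • (S.point ∘ x) = z}
  func {n} F z := {w | ∃ (γ : S.grp) (F₀ : L.Functions n), (S.lang γ).2 n F₀ = F ∧
    ∃ x, γ • (S.point ∘ x) = z ∧ ∃ b ∈ M.func F₀ x, γ • S.point b = w}

theorem smul_mem_rel_witness (δ : S.grp) {n : ℕ} {R : L.Relations n} {z : Fin n → S.translates}
    (h : z ∈ S.witness.rel R) : δ • z ∈ S.witness.rel ((S.lang δ).1 n R) := by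
  obtain ⟨γ, R₀, rfl, x, hx, rfl⟩ := h
  exact ⟨δ * γ, R₀, by rw [map_mul]; rfl, x, hx, mul_smul _ _ _⟩

theorem smul_mem_func_witness (δ : S.grp) {n : ℕ} {F : L.Functions n} {z : Fin n → S.translates}
    {w : S.translates} (h : w ∈ S.witness.func F z) :
    δ • w ∈ S.witness.func ((S.lang δ).2 n F) (δ • z) := by
  obtain ⟨γ, F₀, rfl, x, rfl, b, hb, rfl⟩ := h
  exact ⟨δ * γ, F₀, by rw [map_mul]; rfl, x, mul_smul _ _ _, b, hb, mul_smul _ _ _⟩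

/-- The automorphism of the witness given by an element of the group. -/
def aut (δ : S.grp) : Aut Γ S.witness where
  lang := S.lang δ
  lang_mem := S.lang_mem δ
  toPerm := MulAction.toPerm δ
  isEmbedding :=
    { injective := MulAction.injective δ
      rel_iff := fun R z => by
        change _ ↔ δ • z ∈ _
        refine ⟨S.smul_mem_rel_witness δ, fun h => ?_⟩
        simpa using S.smul_mem_rel_witness δ⁻¹ h
      func_eq := fun F z => by
        change _ = S.witness.func _ (δ • z)
        refine Subset.antisymm (image_subset_iff.2 fun w => S.smul_mem_func_witness δ)
          fun w hw => ?_
        exact ⟨δ⁻¹ • w, by simpa using S.smul_mem_func_witness δ⁻¹ hw, smul_inv_smul δ w⟩ }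

variable {S}

theorem exists_perm_of_smul_subset [Finite A] {γ : S.grp} {T : Set A}
    (h : γ • S.emb '' T ⊆ range S.emb) :
    ∃ σ : Equiv.Perm A, ∀ a ∈ T, γ • S.emb a = S.emb (σ a) := by
  have := Fintype.ofFinite A
  choose! f hf using fun a (ha : a ∈ T) => h (smul_mem_smul_set (mem_image_of_mem S.emb ha))
  have hinj : InjOn f T := fun a ha b hb hab => by
    refine S.emb_injective (MulAction.injective γ ?_)
    exact (hf a ha).symm.trans ((congrArg S.emb hab).trans (hf b hb))
  obtain ⟨e, he⟩ := (mapsTo_univ f T).mono_right (by simp) |>.exists_equiv_extend_of_card_eq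
    (t := Finset.univ) Finset.card_univ.symm hinj
  exact ⟨e.trans (Equiv.subtypeUnivEquiv Finset.mem_univ), fun a ha => by
    rw [← hf a ha, ← he a ha]; rfl⟩

section trace

variable {γ : S.grp} {σ : Equiv.Perm A} {T : Set A}

theorem func_eq_image (hT : M.IsClosed T) (hσ : ∀ a ∈ T, γ • S.emb a = S.emb (σ a)) {n : ℕ}
    (F : L.Functions n) {x : Fin n → A} (hx : ∀ i, x i ∈ T) :
    M.func ((S.lang γ).2 n F) (σ ∘ x) = σ '' M.func F x := by
  refine (S.holds_smul_iff γ γ.2 σ (.func F x (M.func F x)) ?_).2 rfl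
  rintro a (⟨i, rfl⟩ | ha)
  · exact hσ _ (hx i)
  · exact hσ a (hT F x hx ha)

theorem isClosed_image (hT : M.IsClosed T) (hσ : ∀ a ∈ T, γ • S.emb a = S.emb (σ a)) :
    M.IsClosed (σ '' T) := by
  intro n F y hy
  choose x hx hxy using hy
  obtain rfl : σ ∘ x = y := funext hxy
  obtain ⟨F, rfl⟩ := ((S.lang γ).2 n).surjective F
  rw [func_eq_image hT hσ F hx]
  exact image_mono (hT F x hx)

theorem closure_subset_image {a : A} (hT : M.IsClosed T) (ha : a ∈ T)
    (hσ : ∀ a ∈ T, γ • S.emb a = S.emb (σ a)) : M.closure {σ a} ⊆ σ '' M.closure {a} :=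
  GStr.closure_singleton_subset (mem_image_of_mem σ (GStr.mem_closure_singleton a))
    (isClosed_image (GStr.isClosed_closure _) fun b hb =>
      hσ b (GStr.closure_singleton_subset ha hT hb))

theorem image_closure_singleton {a : A} (hT : M.IsClosed T) (ha : a ∈ T)
    (hσ : ∀ a ∈ T, γ • S.emb a = S.emb (σ a)) : σ '' M.closure {a} = M.closure {σ a} := by
  refine Subset.antisymm ?_ (closure_subset_image hT ha hσ)
  have hσ' : ∀ b ∈ σ '' T, γ⁻¹ • S.emb b = S.emb (σ⁻¹ b) := by
    rintro _ ⟨b, hb, rfl⟩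
    rw [← hσ b hb, inv_smul_smul]
    exact congrArg S.emb (σ.symm_apply_apply b).symm
  have h := closure_subset_image (isClosed_image hT hσ) (mem_image_of_mem σ ha) hσ'
  rw [show σ⁻¹ (σ a) = a from σ.symm_apply_apply a] at h
  refine (image_mono h).trans ?_
  rw [← image_comp]
  simp

theorem smul_point (hT : M.IsClosed T) (hσ : ∀ a ∈ T, γ • S.emb a = S.emb (σ a)) {a : A}
    (ha : a ∈ T) : γ • S.point a = S.point (σ a) := by
  refine Subtype.ext (Prod.ext (hσ a ha) ?_)
  change γ • S.emb '' M.closure {a} = S.emb '' M.closure {σ a}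
  rw [← image_closure_singleton hT ha hσ, ← image_smul, image_image, image_image]
  exact image_congr fun b hb => hσ b (GStr.closure_singleton_subset ha hT hb)

end trace

theorem smul_emb_image_closure_subset {γ : S.grp} {a b : A} (h : γ • S.point a = S.point b) :
    γ • S.emb '' M.closure {a} ⊆ range S.emb :=
  (congrArg (fun p => p.1.2) h).trans_subset (image_subset_range S.emb _)

theorem smul_emb_image_core_subset (γ : S.grp) : γ • S.emb '' M.core ⊆ range S.emb :=
  (S.smul_core γ γ.2).trans_subset (image_subset_range S.emb _)

variable (S)

theorem mem_rel_iff_point_comp_mem [Finite A] {n : ℕ} (R : L.Relations n) (x : Fin n → A) :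
    x ∈ M.rel R ↔ S.point ∘ x ∈ S.witness.rel R := by
  refine ⟨fun h => ⟨1, R, rfl, x, h, one_smul _ _⟩, ?_⟩
  rintro ⟨γ, R₀, rfl, y, hy, hyx⟩
  have hyx' (i : Fin n) : γ • S.emb (y i) = S.emb (x i) :=
    congrArg (fun p => p.1.1) (congrFun hyx i)
  obtain ⟨σ, hσ⟩ : ∃ σ : Equiv.Perm A, ∀ a ∈ range y, γ • S.emb a = S.emb (σ a) := by
    refine exists_perm_of_smul_subset ?_
    rintro _ ⟨_, ⟨_, ⟨i, rfl⟩, rfl⟩, rfl⟩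
    exact ⟨x i, (hyx' i).symm⟩
  obtain rfl : σ ∘ y = x := funext fun i =>
    S.emb_injective ((hσ _ (mem_range_self i)).symm.trans (hyx' i))
  exact (S.holds_smul_iff γ γ.2 σ (.rel R₀ y) hσ).2 hy

/-- Constants and unary functions act within the core and within one-generated substructures,
which every translate meeting `M` in their generators shares with `M`. -/
theorem image_point_func [Finite A] (hFun : ∀ n, 2 ≤ n → IsEmpty (L.Functions n)) {n : ℕ}
    (F : L.Functions n) (x : Fin n → A) :
    S.point '' M.func F x = S.witness.func F (S.point ∘ x) := by
  refine Subset.antisymm ?_ ?_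
  · rintro _ ⟨b, hb, rfl⟩
    exact ⟨1, F, rfl, x, one_smul _ _, b, hb, one_smul _ _⟩
  rintro _ ⟨γ, F₀, rfl, y, hyx, b, hb, rfl⟩
  obtain ⟨T, hT, hyT, hγT⟩ : ∃ T, M.IsClosed T ∧ (∀ i, y i ∈ T) ∧ γ • S.emb '' T ⊆ range S.emb := by
    rcases n with _ | _ | n
    · exact ⟨M.core, GStr.isClosed_closure _, Fin.rec0, smul_emb_image_core_subset γ⟩
    · refine ⟨M.closure {y 0}, GStr.isClosed_closure _, fun i => ?_,
        smul_emb_image_closure_subset (congrFun hyx 0)⟩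
      obtain rfl := Subsingleton.elim (α := Fin 1) i 0
      exact GStr.mem_closure_singleton _
    · exact (hFun _ (by omega)).elim F₀
  obtain ⟨σ, hσ⟩ := exists_perm_of_smul_subset hγT
  obtain rfl : σ ∘ y = x := funext fun i =>
    S.point_injective ((smul_point hT hσ (hyT i)).symm.trans (congrFun hyx i))
  rw [func_eq_image hT hσ F₀ hyT]
  exact ⟨σ b, mem_image_of_mem σ hb, (smul_point hT hσ (hT F₀ y hyT hb)).symm⟩

end ExtensionSystem

end witness

section pullback

variable {L : FirstOrder.Language.{u, v}} {A : Type w} {B : Type w'} {Γ : Subgroup (LangPerm L)}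
  {M : GStr L A} {N : GStr L B}

namespace PartialAut

/-- The relation induced by the vertex part of a partial automorphism of `N` along a map into the
vertices of `N`. -/
def pullback (f : PartialAut Γ N) (p : A → B) : SetRel A A :=
  {e | ∃ h : p e.1 ∈ f.dom, (f.map ⟨p e.1, h⟩ : B) = p e.2}

variable {p : A → B} {f g h : PartialAut Γ N}

theorem dom_pullback (hf : f.Within (range p)) : (f.pullback p).dom = p ⁻¹' f.dom := by
  ext a
  refine ⟨fun ⟨_, ha, _⟩ => ha, fun ha => ?_⟩
  obtain ⟨b, hb⟩ := hf.2 (f.map ⟨p a, ha⟩).2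
  exact ⟨b, ha, hb.symm⟩

theorem cod_pullback (hf : f.Within (range p)) : (f.pullback p).cod = p ⁻¹' f.cod := by
  ext b
  constructor
  · rintro ⟨a, ha, hab⟩
    exact hab.subst (f.map _).2
  · intro hb
    obtain ⟨⟨x, hx⟩, hxb⟩ := f.map.surjective ⟨_, hb⟩
    obtain ⟨a, rfl⟩ := hf.1 hx
    exact ⟨a, hx, congrArg Subtype.val hxb⟩

theorem isPartialIso_pullback (hp : GStr.IsEmbedding 1 p M N) (hf : f.Within (range p)) :
    IsPartialIso M f.lang (f.pullback p) where
  isPartialBij := by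
    constructor
    · rintro a a' b ⟨ha, hab⟩ ⟨ha', hab'⟩
      exact hp.injective (Subtype.mk_eq_mk.1 (f.map.injective (Subtype.ext (hab.trans hab'.symm))))
    · rintro a b b' ⟨ha, hab⟩ ⟨_, hab'⟩
      exact hp.injective (hab.symm.trans hab')
  dom_closed := dom_pullback hf ▸ hp.isClosed_preimage f.dom_closed
  cod_closed := cod_pullback hf ▸ hp.isClosed_preimage f.cod_closed
  rel_iff R x y hxy := by
    choose hx hxy using hxy
    rw [hp.rel_iff, hp.rel_iff, show p ∘ y = fun i => (f.map ⟨p (x i), hx i⟩ : B) from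
      (funext hxy).symm]
    exact f.isEmbedding.rel_iff R fun i => ⟨p (x i), hx i⟩
  func_iff F x y a b hxy hab := by
    choose hx hxy using hxy
    obtain ⟨ha, hab⟩ := hab
    rw [hp.mem_func_iff, hp.mem_func_iff, ← hab,
      show p ∘ y = fun i => (f.map ⟨p (x i), hx i⟩ : B) from (funext hxy).symm]
    exact f.isEmbedding.mem_func_iff F (fun i => ⟨p (x i), hx i⟩) ⟨p a, ha⟩

theorem IsCoherentTriple.cod_pullback_eq_dom (hfgh : IsCoherentTriple f g h)
    (hf : f.Within (range p)) (hg : g.Within (range p)) :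
    (f.pullback p).cod = (g.pullback p).dom := by
  rw [cod_pullback hf, dom_pullback hg, hfgh.range_eq_dom]

theorem IsCoherentTriple.pullback_eq (hfgh : IsCoherentTriple f g h) (hf : f.Within (range p)) :
    h.pullback p = f.pullback p ○ g.pullback p := by
  have map_eq {a b : A} (ha : p a ∈ f.dom) (hab : (f.map ⟨p a, ha⟩ : B) = p b)
      (ha' : p a ∈ h.dom) (hb : p b ∈ g.dom) : (h.map ⟨p a, ha'⟩ : B) = g.map ⟨p b, hb⟩ := by
    rw [hfgh.map_eq _ ha (hab ▸ hb) ha']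
    congr 2
    exact Subtype.ext hab
  ext ⟨a, c⟩
  constructor
  · rintro ⟨ha, hac⟩
    have ha' : p a ∈ f.dom := hfgh.dom_eq ▸ ha
    obtain ⟨b, hb⟩ := hf.2 (f.map ⟨p a, ha'⟩).2
    have hbg : p b ∈ g.dom := by
      rw [hb, ← hfgh.range_eq_dom]
      exact (f.map _).2
    exact ⟨b, ⟨ha', hb.symm⟩, hbg, (map_eq ha' hb.symm ha hbg).symm.trans hac⟩
  · rintro ⟨b, ⟨ha, hab⟩, hb, hbc⟩
    exact ⟨hfgh.dom_eq ▸ ha, (map_eq ha hab _ hb).trans hbc⟩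

end PartialAut

end pullback

section isWitness

variable {L : FirstOrder.Language.{u, v}} {A : Type w} [Finite A] {Γ : Subgroup (LangPerm L)}
  {M : GStr L A} {X : Type w'} (hFun : ∀ n, 2 ≤ n → IsEmpty (L.Functions n))

namespace ExtensionSystem

variable (S : ExtensionSystem Γ M X)

/-- The copy of `M` in the witness. -/
def pointEmb : Emb Γ M S.witness where
  lang := 1
  lang_mem := Γ.one_mem
  toFun := S.point
  isEmbedding := ⟨S.point_injective, S.mem_rel_iff_point_comp_mem, S.image_point_func hFun⟩

include hFun in
theorem isEmbedding_smul_point (γ : S.grp) :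
    GStr.IsEmbedding (S.lang γ) (fun a => γ • S.point a) M S.witness :=
  (S.aut γ).isEmbedding.comp (S.pointEmb hFun).isEmbedding

variable {S}

/-- The member of the group which extends the partial automorphism `(g, r)` of `M`. -/
def lifted (S : ExtensionSystem Γ M X) {g : Γ} {r : SetRel A A} (hr : IsPartialIso M g r) : S.grp :=
  ⟨(g, S.lift g r), S.lift_mem hr⟩

theorem lifted_smul_point {g : Γ} {r : SetRel A A} (hr : IsPartialIso M g r) {a b : A}
    (hab : a ~[r] b) : S.lifted hr • S.point a = S.point b := by
  obtain ⟨σ, hσ⟩ := exists_perm_of_smul_subset (γ := S.lifted hr) (T := r.dom)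
    ((S.smul_emb_image_dom hr).trans_subset (image_subset_range _ _))
  have ha : a ∈ r.dom := ⟨b, hab⟩
  rw [smul_point hr.dom_closed hσ ha, S.emb_injective ((hσ a ha).symm.trans (S.lift_apply hr hab))]

omit [Finite A] in
theorem lifted_eq_mul {g g' g'' : Γ} {r r' r'' : SetRel A A} (hr : IsPartialIso M g r)
    (hr' : IsPartialIso M g' r') (hr'' : IsPartialIso M g'' r'') (h : r.cod = r'.dom)
    (hg : g'' = g' * g) (hcomp : r'' = r ○ r') :
    S.lifted hr'' = S.lifted hr' * S.lifted hr := by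
  subst hg hcomp
  exact Subtype.ext (Prod.ext rfl (S.lift_comp hr hr' h))

include hFun in
theorem exists_mem_range_smul_point {V : Set S.translates} (hV : S.witness.IsClosed V)
    (hirr : (S.witness.induce V).Irreducible) {x y : S.translates} (hx : x ∈ V) (hy : y ∈ V) :
    ∃ γ : S.grp, x ∈ range (fun a => γ • S.point a) ∧ y ∈ range (fun a => γ • S.point a) := by
  have hcopy (γ : S.grp) : (S.witness.induce V).IsClosed
      (Subtype.val ⁻¹' range (fun a => γ • S.point a)) := by
    rw [← image_univ]
    exact (GStr.isEmbedding_induce hV).isClosed_preimage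
      ((S.isEmbedding_smul_point hFun γ).isClosed_image GStr.isClosed_univ)
  obtain ⟨z, hxz, hyz⟩ | ⟨n, R, t, ⟨γ, R₀, -, s, -, hst⟩, i, j, hxi, hyj⟩ :=
    hirr.exists_rel_or_closure hFun ⟨x, hx⟩ ⟨y, hy⟩
  · obtain ⟨γ, hz⟩ := S.exists_smul_point_eq z
    exact ⟨γ, GStr.closure_singleton_subset (mem_preimage.2 hz) (hcopy γ) hxz,
      GStr.closure_singleton_subset (mem_preimage.2 hz) (hcopy γ) hyz⟩
  · have ht (i) : t i ∈ Subtype.val ⁻¹' range (fun a => γ • S.point a) := ⟨s i, congrFun hst i⟩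
    exact ⟨γ, GStr.closure_singleton_subset (ht i) (hcopy γ) hxi,
      GStr.closure_singleton_subset (ht j) (hcopy γ) hyj⟩

theorem isIrreducibleStructureFaithful (hS : S.IsTwoDetermined) :
    IsIrreducibleStructureFaithful (S.pointEmb hFun) := by
  intro V hV hirr
  obtain ⟨γ, hγ, h⟩ : S.MapsIn ((fun p : S.translates => p.1.1) '' V) := by
    refine hS _ ?_
    rintro _ ⟨x, hx, rfl⟩ _ ⟨y, hy, rfl⟩
    obtain ⟨γ, ⟨a, rfl⟩, ⟨b, rfl⟩⟩ := exists_mem_range_smul_point hFun hV hirr hx hy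
    refine ⟨γ⁻¹, S.grp.inv_mem γ.2, ?_⟩
    rintro _ ⟨_, rfl | rfl, rfl⟩
    · exact ⟨a, (inv_smul_smul γ (S.emb a)).symm⟩
    · exact ⟨b, (inv_smul_smul γ (S.emb b)).symm⟩
  refine ⟨S.aut ⟨γ, hγ⟩, ?_⟩
  rintro _ ⟨x, hx, rfl⟩
  obtain ⟨δ, a, rfl⟩ := S.exists_smul_point_eq x
  have hT : M.IsClosed ((fun b => δ • S.point b) ⁻¹' V) :=
    (S.isEmbedding_smul_point hFun δ).isClosed_preimage hV
  obtain ⟨σ, hσ⟩ : ∃ σ : Equiv.Perm A, ∀ b ∈ (fun b => δ • S.point b) ⁻¹' V,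
      ((⟨γ, hγ⟩ : S.grp) * δ) • S.emb b = S.emb (σ b) := by
    refine exists_perm_of_smul_subset ?_
    rintro _ ⟨_, ⟨b, hb, rfl⟩, rfl⟩
    exact h ⟨_, mem_image_of_mem _ hb, rfl⟩
  exact ⟨σ a, ((mul_smul _ _ _).symm.trans (smul_point hT hσ hx)).symm⟩

theorem isCoherentEPPAWitness : IsCoherentEPPAWitness (S.pointEmb hFun) := by
  have hr (f : (S.pointEmb hFun).ImagePartialAut) :
      IsPartialIso M (⟨f.1.lang, f.1.lang_mem⟩ : Γ) (f.1.pullback S.point) :=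
    PartialAut.isPartialIso_pullback (S.pointEmb hFun).isEmbedding f.2
  refine ⟨fun f => S.aut (S.lifted (hr f)), fun f => ⟨rfl, ?_⟩,
    fun f g h hfgh => ⟨hfgh.lang_eq, ?_⟩⟩
  · rintro ⟨_, hx⟩
    obtain ⟨a, rfl⟩ := f.2.1 hx
    obtain ⟨b, hb⟩ := f.2.2 (f.1.map ⟨_, hx⟩).2
    exact (lifted_smul_point (hr f) ⟨hx, hb.symm⟩).trans hb
  · have hmul : S.lifted (hr h) = S.lifted (hr g) * S.lifted (hr f) :=
      lifted_eq_mul _ _ _ (hfgh.cod_pullback_eq_dom f.2 g.2) (Subtype.ext hfgh.lang_eq)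
        (hfgh.pullback_eq f.2)
    exact (congrArg MulAction.toPerm hmul).trans (map_mul (MulAction.toPermHom _ _) _ _)

end ExtensionSystem

end isWitness

end EPPA

theorem theorem12p3_general (L : FirstOrder.Language.{u, v}) (Γ : Subgroup (EPPA.LangPerm L))
    (hFun : ∀ n : ℕ, 2 ≤ n → IsEmpty (L.Functions n))
    (A : Type w) [Finite A] (M : EPPA.GStr L A) (horbit : (M.relabelOrbit Γ).Finite) :
    ∃ (B : Type w) (_ : Finite B) (N : EPPA.GStr L B) (ψ : EPPA.Emb Γ M N),
      EPPA.IsCoherentEPPAWitness ψ ∧ EPPA.IsIrreducibleStructureFaithful ψ := by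
  obtain ⟨n, p, _, ⟨S⟩⟩ := EPPA.exists_extensionSystem horbit
  exact ⟨S.coloured.translates, inferInstance, S.coloured.witness, S.coloured.pointEmb hFun,
    EPPA.ExtensionSystem.isCoherentEPPAWitness hFun,
    EPPA.ExtensionSystem.isIrreducibleStructureFaithful hFun S.isTwoDetermined_coloured⟩

theorem theorem12p3 (L : FirstOrder.Language.{u, v}) (Γ : Subgroup (EPPA.LangPerm L))
    (hRel : IsEmpty (L.Relations 0))
    (hFun : ∀ n : ℕ, 2 ≤ n → IsEmpty (L.Functions n))
    (A : Type w) [Finite A] (M : EPPA.GStr L A)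
    (hfix : ∀ g ∈ Γ, ∀ c : L.Functions 0, g.2 0 c = c)
    (hfin : Finite (L.Functions 0))
    (hsing : ∀ c : L.Functions 0, ∃ a : A, M.const c = {a})
    (hdist : ∀ c c' : L.Functions 0, c ≠ c' → M.const c ≠ M.const c')
    (hempty : ∀ (c : L.Functions 0) (F : L.Functions 1) (a : A),
      M.const c = {a} → M.func F ![a] = ∅)
    (horbit : (M.relabelOrbit Γ).Finite) :
    ∃ (B : Type w) (_ : Finite B) (N : EPPA.GStr L B) (ψ : EPPA.Emb Γ M N),
      EPPA.IsCoherentEPPAWitness ψ ∧ EPPA.IsIrreducibleStructureFaithful ψ :=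
  theorem12p3_general L Γ hFun A M horbit
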